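/- Let $n\ge 2$ and $m>n-1$. A \emph{Gaussian generalized random function} on $\mathbb R^n$ is a map $q$ from a probability space $(\Omega,\mathcal H,\mathbb P)$ to the real linear functionals on $C_0^\infty(\mathbb R^n;\mathbb R)$ such that every $\langle q,\phi\rangle$ is a random variable, all finite families $(\langle q,\phi_1\rangle,\dots,\langle q,\phi_l\rangle)$ are jointly Gaussian, and for each compact $K\subset\mathbb R^n$ there are $N\in\mathbb N$ and a non-negative random variable $C$ with $\mathbb E C^2<\infty$ such that almost surely $|\langle q,\phi\rangle|\le C\sum_{|\alpha|\le N}\sup|\partial^\alpha\phi|$ for all $\phi$ with $\operatorname{supp}\phi\subset K$. It is \emph{microlocally isotropic of order $-m$ in} a bounded domain $D\subset\mathbb R^n$, with \emph{local strength} $\mu$, if $\mathbb E q$ is a smooth function, $\operatorname{supp}q\subset D$ almost surely, and the covariance operator, $\langle C_q\phi,\psi\rangle=\operatorname{Cov}(\langle q,\phi\rangle,\langle q,\psi\rangle)$, is a classical pseudodifferential operator of order $-m$ with principal symbol $\mu(x)|\xi|^{-m}$, where $\mu\in C_0^\infty(\mathbb R^n;\mathbb R)$, $\mu\ge0$ and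 $\operatorname{supp}\mu\subset D$. For $k>0$ and $\theta\in\mathbb S^{n-1}$ the single-scattering (Born) backscattered far field is $u_1^\infty(k,\theta,-\theta)=c_n\langle q, e^{ik\theta\cdot y}e^{ik\theta\cdot y}\rangle$, where $c_n\neq0$ is a fixed constant (the normalization of the far field), and for $\tau\ge0$ $$M_1(\tau,\theta)=\lim_{K\to\infty}\frac1K\int_K^{2K}k^m\,u_1^\infty(k,\theta,-\theta)\,\overline{u_1^\infty(k+\tau,\theta,-\theta)}\,dk .$$ \textbf{Theorem.} Let $\{(\tau_j,\theta_j):j\in\mathbb N\}$ be any dense subset of $[0,\infty)\times\mathbb S^{n-1}$. Then the data $\{M_1(\tau_j,\theta_j):j\in\mathbb N\}$ determine the local strength almost surely: there is a (deterministic) map $\mathcal R$ from complex sequences to functions on $\mathbb R^n$, depending only on $n$, $m$, $c_n$ and the sequence $(\tau_j,\theta_j)_j$, such that for every bounded domain $D$ and every Gaussian microlocally isotropic random field $q$ of order $-m$ in $D$ with local strength $\mu$, almost surely all the limits $M_1(\tau_j,\theta_j)$ exist and $\mathcal R\big((M_1(\tau_j,\theta_j))_{j\in\mathbb N}\big)=\mu$.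 -/

import Mathlib

open MeasureTheory ProbabilityTheory Filter Topology Set
open scoped NNReal ContDiff Distributions

universe u

noncomputable section

/-- Euclidean space `ℝⁿ`. -/
abbrev Rn (n : ℕ) : Type := EuclideanSpace ℝ (Fin n)

/-- The space `C₀^∞(ℝⁿ; ℝ)` of real-valued smooth functions with compact support. -/
abbrev RealTest (n : ℕ) : Type := 𝓓((⊤ : TopologicalSpace.Opens (Rn n)), ℝ)

/-! ### Symbols and pseudodifferential operators -/

/-- The class `S^d(ℝⁿ × ℝⁿ)`: smooth functions `c(x, ξ)` all of whose derivatives of order `j` in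
`x` and `k` in `ξ` are bounded by a constant times `(1 + |ξ|)^(d - k)`. -/
def IsSymbol {n : ℕ} (d : ℝ) (c : Rn n → Rn n → ℂ) : Prop :=
  ContDiff ℝ ∞ (fun p : Rn n × Rn n => c p.1 p.2) ∧
  ∀ j k : ℕ, ∃ C : ℝ, ∀ x ξ : Rn n,
    ‖iteratedFDeriv ℝ j (fun y => iteratedFDeriv ℝ k (c y) ξ) x‖ ≤ C * (1 + ‖ξ‖) ^ (d - k)

/-- `c` is a classical (polyhomogeneous) symbol of order `d`, with asymptotic expansion
`c ∼ a₀ + a₁ + a₂ + ⋯`, where `a_j(x, ξ)` is smooth for `ξ ≠ 0` and positively homogeneous of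
degree `d - j` in `ξ`. The term `a₀` is the principal symbol. -/
structure IsClassicalSymbol {n : ℕ} (d : ℝ) (c : Rn n → Rn n → ℂ)
    (a : ℕ → Rn n → Rn n → ℂ) : Prop where
  isSymbol : IsSymbol d c
  smooth : ∀ j, ContDiffOn ℝ ∞ (fun p : Rn n × Rn n => a j p.1 p.2) {p | p.2 ≠ 0}
  homogeneous : ∀ (j : ℕ) (x ξ : Rn n), ξ ≠ 0 → ∀ t : ℝ, 0 < t →
    a j x (t • ξ) = ((t ^ (d - j) : ℝ) : ℂ) * a j x ξ
  expansion : ∀ N : ℕ, ∃ r : Rn n → Rn n → ℂ, IsSymbol (d - N) r ∧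
    ∀ x ξ : Rn n, 1 ≤ ‖ξ‖ → c x ξ = (∑ j ∈ Finset.range N, a j x ξ) + r x ξ

/-- The plane wave `y ↦ exp(i ξ · y)`. -/
def planeWave {n : ℕ} (ξ : Rn n) (y : Rn n) : ℂ :=
  Complex.exp (Complex.I * ((inner ℝ ξ y : ℝ) : ℂ))

/-- The pseudodifferential operator with symbol `c`,
`(2π)^(-n) ∫ ∫ exp(i (x - y) · ξ) c(x, ξ) φ(y) dy dξ`. -/
def pseudoOp {n : ℕ} (c : Rn n → Rn n → ℂ) (φ : Rn n → ℝ) (x : Rn n) : ℂ :=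
  (((2 * Real.pi) ^ n : ℝ) : ℂ)⁻¹ *
    ∫ ξ : Rn n, ∫ y : Rn n, planeWave ξ (x - y) * c x ξ * ((φ y : ℝ) : ℂ)

/-! ### Generalized random functions -/

variable {Ω : Type u} [MeasurableSpace Ω] {n : ℕ}

/-- `q` is a generalized random function on `ℝⁿ`: every realization is a linear functional on
`C₀^∞(ℝⁿ; ℝ)`, every pairing `⟨q, φ⟩` is a random variable, and on each compact set `q` is almost
surely a distribution of finite order with a square-integrable random constant. -/
structure IsGeneralizedRandomFunction (P : Measure Ω) (q : Ω → RealTest n →ₗ[ℝ] ℝ) : Prop where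
  measurable : ∀ φ : RealTest n, Measurable fun w => q w φ
  bound : ∀ K : Set (Rn n), IsCompact K → ∃ (C : Ω → ℝ) (N : ℕ),
    Measurable C ∧ (∀ w, 0 ≤ C w) ∧ MemLp C 2 P ∧
    ∀ᵐ w ∂P, ∀ φ : RealTest n, tsupport φ ⊆ K →
      |q w φ| ≤ C w * ∑ i ∈ Finset.range (N + 1), ⨆ x : Rn n, ‖iteratedFDeriv ℝ i φ x‖

/-- A Gaussian generalized random function: the pairings with any finitely many test functions are
jointly Gaussian (possibly degenerate). -/
structure IsGaussianGeneralizedRandomFunction (P : Measure Ω)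
    (q : Ω → RealTest n →ₗ[ℝ] ℝ) : Prop extends IsGeneralizedRandomFunction P q where
  gaussian : IsGaussianProcess (fun (φ : RealTest n) (w : Ω) => q w φ) P

/-- `q` is microlocally isotropic of order `-m` in `D`, with local strength `μ`. -/
structure IsMicrolocallyIsotropic (P : Measure Ω) (q : Ω → RealTest n →ₗ[ℝ] ℝ)
    (D : Set (Rn n)) (m : ℝ) (μ : Rn n → ℝ) : Prop where
  /-- the expected potential is a smooth function -/
  mean_smooth : ∃ g : Rn n → ℝ, ContDiff ℝ ∞ g ∧
    ∀ φ : RealTest n, ∫ w, q w φ ∂P = ∫ x, g x * φ x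
  /-- almost every realization is supported in `D` -/
  support : ∀ᵐ w ∂P, Distribution.dsupport (q w) ⊆ D
  /-- the local strength is smooth, compactly supported in `D`, and non-negative -/
  strength_smooth : ContDiff ℝ ∞ μ
  strength_compact : HasCompactSupport μ
  strength_support : tsupport μ ⊆ D
  strength_nonneg : ∀ x, 0 ≤ μ x
  /-- the covariance operator is a classical pseudodifferential operator of order `-m` with
  principal symbol `μ(x) |ξ|^(-m)` -/
  covariance : ∃ (c : Rn n → Rn n → ℂ) (a : ℕ → Rn n → Rn n → ℂ),
    IsClassicalSymbol (-m) c a ∧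
    (∀ x ξ : Rn n, ξ ≠ 0 → a 0 x ξ = ((μ x * ‖ξ‖ ^ (-m) : ℝ) : ℂ)) ∧
    ∀ φ ψ : RealTest n,
      ((cov[fun w => q w φ, fun w => q w ψ; P] : ℝ) : ℂ) =
        ∫ x, pseudoOp c φ x * ((ψ x : ℝ) : ℂ)

/-! ### Pairing a compactly supported distribution with a smooth function -/

/-- A smooth cutoff, equal to `1` on the ball of radius `N + 1` and supported in the ball of
radius `N + 2` about the origin. -/
def cutoff (n N : ℕ) : ContDiffBump (0 : Rn n) where
  rIn := N + 1
  rOut := N + 2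
  rIn_pos := by positivity
  rIn_lt_rOut := by linarith

/-- The test function `χ_N f`, with `χ_N` the cutoff above. -/
def cutoffMul (N : ℕ) (f : Rn n → ℝ) (hf : ContDiff ℝ ∞ f) : RealTest n where
  toFun x := cutoff n N x * f x
  contDiff' := (cutoff n N).contDiff.mul hf
  hasCompactSupport' := (cutoff n N).hasCompactSupport.mul_right
  tsupport_subset' := fun _ _ => trivial

/-- The pairing `⟨v, f⟩` of a compactly supported distribution `v` with a smooth real function `f`:
the eventually constant value of `⟨v, χ_N f⟩`. -/
def realPairing (v : RealTest n →ₗ[ℝ] ℝ) (f : Rn n → ℝ) (hf : ContDiff ℝ ∞ f) : ℝ :=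
  limUnder atTop fun N : ℕ => v (cutoffMul N f hf)

/-- The pairing with a smooth complex function, `⟨v, f⟩ = ⟨v, Re f⟩ + i ⟨v, Im f⟩`. -/
def complexPairing (v : RealTest n →ₗ[ℝ] ℝ) (f : Rn n → ℂ) (hf : ContDiff ℝ ∞ f) : ℂ :=
  (realPairing v (fun x => (f x).re) (Complex.reCLM.contDiff.comp hf) : ℂ) +
    Complex.I * (realPairing v (fun x => (f x).im) (Complex.imCLM.contDiff.comp hf) : ℂ)

/-! ### Single-scattering data -/

theorem contDiff_planeWave (ξ : Rn n) : ContDiff ℝ ∞ (planeWave ξ) := by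
  unfold planeWave
  exact Complex.contDiff_exp.comp (contDiff_const.mul
    (Complex.ofRealCLM.contDiff.comp (contDiff_const.inner ℝ contDiff_id)))

/-- The far field of first-order (Born) scattering of the plane wave `u₀(y) = exp(i k θ · y)` by
the potential `v`, observed in direction `η`:
`u₁^∞(k, θ, η) = cₙ ∫ exp(-i k η · y) v(y) u₀(y) dy`, understood as a distributional pairing. -/
def bornFarField (cn : ℂ) (v : RealTest n →ₗ[ℝ] ℝ) (k : ℝ) (θ η : Rn n) : ℂ :=
  cn * complexPairing v (fun y => planeWave (-(k • η)) y * planeWave (k • θ) y)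
    ((contDiff_planeWave _).mul (contDiff_planeWave _))

/-- The integrand `k^m u₁^∞(k, θ, -θ) conj(u₁^∞(k + τ, θ, -θ))` of the backscattering data. -/
def bornIntegrand (cn : ℂ) (m : ℝ) (v : RealTest n →ₗ[ℝ] ℝ) (τ : ℝ) (θ : Rn n) (k : ℝ) : ℂ :=
  ((k ^ m : ℝ) : ℂ) * bornFarField cn v k θ (-θ) *
    (starRingEnd ℂ) (bornFarField cn v (k + τ) θ (-θ))

/-- The single-scattering datum
`M₁(τ, θ) = lim_{K → ∞} K⁻¹ ∫_K^{2K} k^m u₁^∞(k, θ, -θ) conj(u₁^∞(k + τ, θ, -θ)) dk`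
of the potential `v` exists and equals `z`. -/
def HasSingleScatteringDatum (cn : ℂ) (m : ℝ) (v : RealTest n →ₗ[ℝ] ℝ) (τ : ℝ) (θ : Rn n)
    (z : ℂ) : Prop :=
  (∀ K : ℝ, 0 < K → IntervalIntegrable (bornIntegrand cn m v τ θ) volume K (2 * K)) ∧
  Tendsto (fun K : ℝ => ((K : ℝ) : ℂ)⁻¹ * ∫ k in K..(2 * K), bornIntegrand cn m v τ θ k)
    atTop (𝓝 z)

end

noncomputable section

/-! ### Fourth moments of Gaussian variables -/

/-! In backscattering the incident and observation phases combine into one plane wave of frequency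
`2kθ`, so the far field is `cn` times the Fourier–Laplace transform of `q` at `2kθ`
(`bornFarField_eq`). The data are therefore time averages of products of two such transforms, and
two facts are needed: the mean of the product has a limit, and the fluctuation averages out almost
surely.

Mean. A pseudodifferential operator acts on a modulated cutoff `χ e^{iζ·y}` by multiplication with
its symbol at `ζ`, up to one order. With principal symbol `μ(x)|ξ|^(-m)`, the product of the
transforms at `ζ` and `ζ'` has mean `|ζ|^(-m) μ̂(ζ + ζ')` with an error of order `|ζ|^(-m-1)`
(`exists_norm_integral_fieldTransform_mul_sub_le`). Here `μ̂` is `waveTransform μ`, and the mean of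
`q` contributes only a rapidly decaying term. At `ζ = 2kθ`, `ζ' = -2(k+τ)θ`, after multiplication by
`k^m`, the limit is `2^(-m) μ̂(-2τθ)`.

Fluctuation. Since `μ̂` decays, the real processes `k^(m/2) ⟨q, χ cos⟩` and `k^(m/2) ⟨q, χ sin⟩`
have correlations `O((1+|t-s|)⁻¹)` (`exists_abs_integral_scaledWaveTest_mul_le`). For Gaussian
variables the covariance of squares is at most twice the squared correlation, hence
`O((1+|t-s|)⁻²)`, which is integrable. A second-moment and Borel–Cantelli type argument along the
times `j²` then gives a strong law (`ae_tendsto_average_zero`), and polarization carries it from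
squares to products (`ae_tendsto_average_mul`).

Recovery. Almost surely all of the countably many data equal `|cn|² 2^(-m) μ̂(-2τ_jθ_j)`. By
continuity and density they fix `μ̂` everywhere, and Fourier inversion fixes `μ`
(`eq_of_waveTransform_eq_on_dense`). -/

theorem iteratedDeriv_four_gaussian_mgf (h v : ℝ) :
    iteratedDeriv 4 (fun t : ℝ => Real.exp (h * t + v * t ^ 2 / 2)) 0
      = 3 * v ^ 2 + 6 * v * h ^ 2 + h ^ 4 := by
  -- Polynomial multiples of the exponential are stable under differentiation. Cubic coefficients
  -- suffice, since the last differentiated factor has degree three.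
  have key : ∀ (p p' : ℝ → ℝ), (∀ t, HasDerivAt p (p' t) t) →
      deriv (fun t : ℝ => p t * Real.exp (h * t + v * t ^ 2 / 2))
        = fun t => (p' t + p t * (h + v * t)) * Real.exp (h * t + v * t ^ 2 / 2) := by
    intro p p' hp
    ext t
    have h1 : HasDerivAt (fun t : ℝ => h * t + v * t ^ 2 / 2) (h + v * t) t := by
      have := ((hasDerivAt_id t).const_mul h).add
        ((((hasDerivAt_id t).pow 2).const_mul v).div_const 2)
      refine HasDerivAt.congr_deriv (f' := _) this ?_
      simp
      ring
    have := (hp t).fun_mul h1.exp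
    rw [this.deriv]
    ring
  have hpoly : ∀ a b c d t : ℝ, HasDerivAt (fun t : ℝ => a + b * t + c * t ^ 2 + d * t ^ 3)
      (b + 2 * c * t + 3 * d * t ^ 2) t := by
    intro a b c d t
    have := (((hasDerivAt_const t a).add ((hasDerivAt_id t).const_mul b)).add
      (((hasDerivAt_id t).pow 2).const_mul c)).add (((hasDerivAt_id t).pow 3).const_mul d)
    refine HasDerivAt.congr_deriv (f' := _) this ?_
    simp
    ring
  have d1 := key _ _ (hpoly 1 0 0 0)
  have d2 := key _ _ (hpoly h v 0 0)
  have d3 := key _ _ (hpoly (h ^ 2 + v) (2 * h * v) (v ^ 2) 0)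
  have d4 := key _ _ (hpoly (h ^ 3 + 3 * h * v) (3 * h ^ 2 * v + 3 * v ^ 2) (3 * h * v ^ 2) (v ^ 3))
  have e0 : (fun t : ℝ => Real.exp (h * t + v * t ^ 2 / 2))
      = fun t => (1 + 0 * t + 0 * t ^ 2 + 0 * t ^ 3) * Real.exp (h * t + v * t ^ 2 / 2) := by
    ext t; ring
  rw [iteratedDeriv_succ', iteratedDeriv_succ', iteratedDeriv_succ', iteratedDeriv_one, e0, d1]
  rw [show (fun t : ℝ => (0 + 2 * 0 * t + 3 * 0 * t ^ 2 + (1 + 0 * t + 0 * t ^ 2 + 0 * t ^ 3) *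
      (h + v * t)) * Real.exp (h * t + v * t ^ 2 / 2)) = fun t => (h + v * t + 0 * t ^ 2 + 0 * t ^ 3)
      * Real.exp (h * t + v * t ^ 2 / 2) by ext t; ring, d2]
  rw [show (fun t : ℝ => (v + 2 * 0 * t + 3 * 0 * t ^ 2 + (h + v * t + 0 * t ^ 2 + 0 * t ^ 3) *
      (h + v * t)) * Real.exp (h * t + v * t ^ 2 / 2)) = fun t => (h ^ 2 + v + 2 * h * v * t +
      v ^ 2 * t ^ 2 + 0 * t ^ 3) * Real.exp (h * t + v * t ^ 2 / 2) by ext t; ring, d3]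
  rw [show (fun t : ℝ => (2 * h * v + 2 * v ^ 2 * t + 3 * 0 * t ^ 2 + (h ^ 2 + v + 2 * h * v * t +
      v ^ 2 * t ^ 2 + 0 * t ^ 3) * (h + v * t)) * Real.exp (h * t + v * t ^ 2 / 2)) =
      fun t => (h ^ 3 + 3 * h * v + (3 * h ^ 2 * v + 3 * v ^ 2) * t + 3 * h * v ^ 2 * t ^ 2 +
      v ^ 3 * t ^ 3) * Real.exp (h * t + v * t ^ 2 / 2) by ext t; ring, d4]
  simp
  ring

theorem integral_pow_four_gaussianReal (h : ℝ) (v : ℝ≥0) :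
    ∫ x, x ^ 4 ∂gaussianReal h v = 3 * (v : ℝ) ^ 2 + 6 * v * h ^ 2 + h ^ 4 := by
  have h1 : ∫ x, x ^ 4 ∂gaussianReal h v
      = iteratedDeriv 4 (mgf (fun x ↦ x) (gaussianReal h v)) 0 := by
    rw [iteratedDeriv_mgf_zero] <;> simp
  rw [h1, mgf_fun_id_gaussianReal, iteratedDeriv_four_gaussian_mgf]

theorem integral_sq_gaussianReal (h : ℝ) (v : ℝ≥0) :
    ∫ x, x ^ 2 ∂gaussianReal h v = (v : ℝ) + h ^ 2 := by
  have h1 := variance_eq_sub (μ := gaussianReal h v) (memLp_id_gaussianReal' 2 (by simp))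
  simp at h1
  linarith

section

variable {Ω : Type*} [MeasurableSpace Ω] {P : Measure Ω}

theorem ProbabilityTheory.HasGaussianLaw.integral_pow_four {X : Ω → ℝ} (hX : HasGaussianLaw X P) :
    ∫ w, X w ^ 4 ∂P = 3 * (∫ w, X w ^ 2 ∂P) ^ 2 - 2 * (∫ w, X w ∂P) ^ 4 := by
  have hP := hX.isProbabilityMeasure
  have hm : AEMeasurable X P := hX.aemeasurable
  have h4 : ∫ w, X w ^ 4 ∂P = ∫ x, x ^ 4 ∂(P.map X) := by
    rw [integral_map hm (by fun_prop)]
  have h2 : ∫ w, X w ^ 2 ∂P = ∫ x, x ^ 2 ∂(P.map X) := by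
    rw [integral_map hm (by fun_prop)]
  rw [h4, h2, hX.map_eq_gaussianReal, integral_pow_four_gaussianReal, integral_sq_gaussianReal]
  ring

theorem ProbabilityTheory.HasGaussianLaw.integrable_pow_mul_pow {X Y : Ω → ℝ}
    (hX : HasGaussianLaw X P) (hY : HasGaussianLaw Y P) (i j : ℕ) :
    Integrable (fun w => X w ^ i * Y w ^ j) P := by
  have hP := hX.isProbabilityMeasure
  have h : ∀ {Z : Ω → ℝ}, HasGaussianLaw Z P → ∀ k : ℕ, MemLp (fun w => Z w ^ k) 2 P := by
    intro Z hZ k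
    have := (hZ.memLp (p := ((2 * k : ℕ) : ENNReal)) (ENNReal.natCast_ne_top _))
    refine (memLp_two_iff_integrable_sq (hZ.aemeasurable.aestronglyMeasurable.pow k)).2 ?_
    rcases Nat.eq_zero_or_pos k with rfl | hk
    · simp
    · have h2 := this.integrable_norm_pow (by omega)
      refine h2.congr (ae_of_all _ fun w => ?_)
      simp only [Real.norm_eq_abs, Pi.pow_apply, pow_mul, sq_abs]
      rw [← pow_mul, ← pow_mul, mul_comm]
  exact (h hX i).integrable_mul (h hY j)

/-- Products of squares of jointly Gaussian variables, which need not be centred. -/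
theorem ProbabilityTheory.HasGaussianLaw.integral_sq_mul_sq_le {X Y : Ω → ℝ}
    (hX : HasGaussianLaw X P) (hY : HasGaussianLaw Y P)
    (ha : HasGaussianLaw (fun w => X w + Y w) P) (hs : HasGaussianLaw (fun w => X w - Y w) P) :
    ∫ w, X w ^ 2 * Y w ^ 2 ∂P
      ≤ (∫ w, X w ^ 2 ∂P) * (∫ w, Y w ^ 2 ∂P) + 2 * (∫ w, X w * Y w ∂P) ^ 2 := by
  have hi := fun i j => hX.integrable_pow_mul_pow hY i j
  have iX : Integrable X P := by simpa using hi 1 0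
  have iY : Integrable Y P := by simpa using hi 0 1
  have iXX : Integrable (fun w => X w ^ 2) P := by simpa using hi 2 0
  have iYY : Integrable (fun w => Y w ^ 2) P := by simpa using hi 0 2
  have iXY : Integrable (fun w => X w * Y w) P := by simpa using hi 1 1
  have iX4 : Integrable (fun w => X w ^ 4) P := by simpa using hi 4 0
  have iY4 : Integrable (fun w => Y w ^ 4) P := by simpa using hi 0 4
  have i22 := hi 2 2
  -- Polarization isolates the mixed moment from four one-dimensional fourth moments. The result is
  -- an identity with the extra term `-2 (EX)² (EY)²`, whose sign permits dropping it.
  have e4 : (∫ w, (X w + Y w) ^ 4 ∂P) + ∫ w, (X w - Y w) ^ 4 ∂P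
      = 2 * (∫ w, X w ^ 4 ∂P) + 12 * (∫ w, X w ^ 2 * Y w ^ 2 ∂P) + 2 * ∫ w, Y w ^ 4 ∂P := by
    rw [← integral_add, ← integral_const_mul, ← integral_const_mul, ← integral_const_mul,
      ← integral_add, ← integral_add]
    · congr 1; ext w; ring
    · exact (iX4.const_mul 2).add (i22.const_mul 12)
    · exact iY4.const_mul 2
    · exact iX4.const_mul 2
    · exact i22.const_mul 12
    · simpa using ha.integrable_pow_mul_pow hs 4 0
    · simpa using ha.integrable_pow_mul_pow hs 0 4
  have e2a : ∫ w, (X w + Y w) ^ 2 ∂P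
      = (∫ w, X w ^ 2 ∂P) + 2 * (∫ w, X w * Y w ∂P) + ∫ w, Y w ^ 2 ∂P := by
    rw [← integral_const_mul, ← integral_add iXX (iXY.const_mul 2),
      ← integral_add (f := fun w => X w ^ 2 + 2 * (X w * Y w)) (iXX.add (iXY.const_mul 2)) iYY]
    congr 1; ext w; ring
  have e2s : ∫ w, (X w - Y w) ^ 2 ∂P
      = (∫ w, X w ^ 2 ∂P) - 2 * (∫ w, X w * Y w ∂P) + ∫ w, Y w ^ 2 ∂P := by
    rw [← integral_const_mul, ← integral_sub iXX (iXY.const_mul 2),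
      ← integral_add (f := fun w => X w ^ 2 - 2 * (X w * Y w)) (iXX.sub (iXY.const_mul 2)) iYY]
    congr 1; ext w; ring
  rw [ha.integral_pow_four, hs.integral_pow_four, hX.integral_pow_four, hY.integral_pow_four,
    e2a, e2s, integral_add iX iY, integral_sub iX iY] at e4
  nlinarith [sq_nonneg ((∫ w, X w ∂P) * (∫ w, Y w ∂P))]

end

/-! ### A law of large numbers for time averages -/

section

variable {Ω : Type*} [MeasurableSpace Ω] {P : Measure Ω}

/-- Plays the role of Borel–Cantelli: a nonnegative series with finite expectation converges almost
surely, so its terms vanish in the limit. -/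
theorem ae_tendsto_zero_of_tsum_lintegral_ne_top {f : ℕ → Ω → ENNReal}
    (hf : ∀ j, AEMeasurable (f j) P) (h : ∑' j, ∫⁻ w, f j w ∂P ≠ ⊤) :
    ∀ᵐ w ∂P, Tendsto (fun j => f j w) atTop (𝓝 0) := by
  rw [← lintegral_tsum hf] at h
  filter_upwards [ae_lt_top' (AEMeasurable.tsum hf) h] with w hw
  exact ENNReal.tendsto_atTop_zero_of_tsum_ne_top hw.ne

theorem sq_lintegral_le {α : Type*} [MeasurableSpace α] (ν : Measure α) {f : α → ENNReal}
    (hf : AEMeasurable f ν) : (∫⁻ x, f x ∂ν) ^ 2 ≤ ν univ * ∫⁻ x, f x ^ 2 ∂ν := by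
  have h := ENNReal.lintegral_mul_le_Lp_mul_Lq ν (p := 2) (q := 2)
    ⟨by norm_num, by norm_num, by norm_num⟩ (f := fun _ => 1) (g := f) (by fun_prop) hf
  simp only [Pi.mul_apply, one_mul, one_pow, lintegral_const, ENNReal.rpow_two] at h
  have h2 := pow_le_pow_left' h 2
  refine h2.trans (le_of_eq ?_)
  rw [mul_pow, ← ENNReal.rpow_two, ← ENNReal.rpow_two, ← ENNReal.rpow_mul, ← ENNReal.rpow_mul]
  norm_num

variable [IsProbabilityMeasure P] {Z : ℝ → Ω → ℝ}

/-- Cauchy–Schwarz in time followed by Tonelli. No decorrelation enters, so the bound is quadratic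
in the length; it serves for integrability and for the short blocks between consecutive squares. -/
theorem lintegral_sq_lintegral_enorm_le (hZ : Measurable (fun p : ℝ × Ω => Z p.1 p.2)) {M : ENNReal}
    (hM : ∀ t, 1 ≤ t → ∫⁻ w, ‖Z t w‖ₑ ^ 2 ∂P ≤ M) {a b : ℝ} (ha : 1 ≤ a) :
    ∫⁻ w, (∫⁻ t in Ioc a b, ‖Z t w‖ₑ) ^ 2 ∂P ≤ ENNReal.ofReal (b - a) ^ 2 * M := by
  have hm : ∀ w, Measurable fun t => Z t w := fun w =>
    Measurable.comp hZ (measurable_prodMk_right (y := w))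
  have hsw : Measurable (fun p : Ω × ℝ => Z p.2 p.1) := hZ.comp measurable_swap
  calc ∫⁻ w, (∫⁻ t in Ioc a b, ‖Z t w‖ₑ) ^ 2 ∂P
      ≤ ∫⁻ w, ENNReal.ofReal (b - a) * (∫⁻ t in Ioc a b, ‖Z t w‖ₑ ^ 2) ∂P := by
        refine lintegral_mono fun w => ?_
        have := sq_lintegral_le (volume.restrict (Ioc a b)) (f := fun t => ‖Z t w‖ₑ)
          (hm w).enorm.aemeasurable
        simpa using this
    _ = ENNReal.ofReal (b - a) * ∫⁻ w, (∫⁻ t in Ioc a b, ‖Z t w‖ₑ ^ 2) ∂P := by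
        rw [lintegral_const_mul]
        exact (hsw.enorm.pow_const 2).lintegral_prod_right'
    _ = ENNReal.ofReal (b - a) * ∫⁻ t in Ioc a b, (∫⁻ w, ‖Z t w‖ₑ ^ 2 ∂P) := by
        rw [lintegral_lintegral_swap]
        exact (hsw.enorm.pow_const 2).aemeasurable
    _ ≤ ENNReal.ofReal (b - a) * ∫⁻ _ in Ioc a b, M := by
        refine mul_le_mul_right ?_ _
        exact setLIntegral_mono' measurableSet_Ioc fun t ht => hM t (ha.trans ht.1.le)
    _ = ENNReal.ofReal (b - a) ^ 2 * M := by
        rw [setLIntegral_const, Real.volume_Ioc]; ring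

theorem integrable_one_add_abs_rpow_neg_two : Integrable fun u : ℝ => (1 + |u|) ^ (-2 : ℝ) := by
  have := integrable_one_add_norm (E := ℝ) (μ := volume) (r := 2) (by simp)
  simpa using this

/-- By Fubini the second moment is the double time integral of the correlations. Integrability of
the kernel in `t - s` makes it linear, rather than quadratic, in the length; this gain drives the
strong law. -/
theorem lintegral_sq_integral_le (hZ : Measurable (fun p : ℝ × Ω => Z p.1 p.2)) {C : ℝ}
    (hL : ∀ t, 1 ≤ t → MemLp (Z t) 2 P)
    (hC : ∀ t s, 1 ≤ t → 1 ≤ s → ∫ w, Z t w * Z s w ∂P ≤ C * (1 + |t - s|) ^ (-2 : ℝ))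
    {N : ℝ} (hN : 1 ≤ N) :
    ∫⁻ w, ‖∫ t in Ioc 1 N, Z t w‖ₑ ^ 2 ∂P
      ≤ ENNReal.ofReal (C * (∫ u : ℝ, (1 + |u|) ^ (-2 : ℝ)) * (N - 1)) := by
  have hM : ∀ t, 1 ≤ t → ∫⁻ w, ‖Z t w‖ₑ ^ 2 ∂P ≤ ENNReal.ofReal C := by
    intro t ht
    have h1 := hC t t ht ht
    simp only [sub_self, abs_zero, add_zero, Real.one_rpow, mul_one] at h1
    have h2 : ∀ w, ‖Z t w‖ₑ ^ 2 = ENNReal.ofReal (Z t w * Z t w) := by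
      intro w
      rw [← ofReal_norm, ← ENNReal.ofReal_pow (norm_nonneg _), Real.norm_eq_abs, sq_abs, sq]
    simp_rw [h2]
    rw [← ofReal_integral_eq_lintegral_ofReal]
    · exact ENNReal.ofReal_le_ofReal h1
    · exact (hL t ht).integrable_mul (hL t ht)
    · exact ae_of_all _ fun w => mul_self_nonneg _
  have hC0 : 0 ≤ C := by
    have h1 := hC 1 1 le_rfl le_rfl
    simp only [sub_self, abs_zero, add_zero, Real.one_rpow, mul_one] at h1
    exact (integral_nonneg fun w => mul_self_nonneg _).trans h1
  set ν := volume.restrict (Ioc (1 : ℝ) N) with hν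
  have hm : ∀ w, Measurable fun t => Z t w := fun w =>
    Measurable.comp hZ (measurable_prodMk_right (y := w))
  have hGm : Measurable fun p : Ω × (ℝ × ℝ) => Z p.2.1 p.1 * Z p.2.2 p.1 :=
    (hZ.comp (measurable_snd.fst.prodMk measurable_fst)).mul
      (hZ.comp (measurable_snd.snd.prodMk measurable_fst))
  have hG : Integrable (fun p : Ω × (ℝ × ℝ) => Z p.2.1 p.1 * Z p.2.2 p.1) (P.prod (ν.prod ν)) := by
    refine ⟨hGm.aestronglyMeasurable, ?_⟩
    rw [hasFiniteIntegral_iff_enorm, lintegral_prod _ hGm.enorm.aemeasurable]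
    have : ∀ w, ∫⁻ y, ‖Z y.1 w * Z y.2 w‖ₑ ∂(ν.prod ν) = (∫⁻ t, ‖Z t w‖ₑ ∂ν) ^ 2 := by
      intro w
      simp_rw [enorm_mul]
      rw [lintegral_prod_mul (hm w).enorm.aemeasurable (hm w).enorm.aemeasurable, sq]
    simp_rw [this]
    refine (lintegral_sq_lintegral_enorm_le hZ hM le_rfl).trans_lt ?_
    exact ENNReal.mul_lt_top (ENNReal.pow_lt_top ENNReal.ofReal_lt_top) ENNReal.ofReal_lt_top
  have hT : ∀ w, ∫ y, Z y.1 w * Z y.2 w ∂(ν.prod ν) = (∫ t, Z t w ∂ν) ^ 2 := by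
    intro w
    rw [integral_prod_mul (fun t => Z t w) (fun t => Z t w), sq]
  have hTi : Integrable (fun w => (∫ t, Z t w ∂ν) ^ 2) P := by
    have := hG.integral_prod_left
    simpa only [hT] using this
  have h2 : ∀ w, ‖∫ t, Z t w ∂ν‖ₑ ^ 2 = ENNReal.ofReal ((∫ t, Z t w ∂ν) ^ 2) := by
    intro w
    rw [← ofReal_norm, ← ENNReal.ofReal_pow (norm_nonneg _), Real.norm_eq_abs, sq_abs]
  simp_rw [h2]
  rw [← ofReal_integral_eq_lintegral_ofReal hTi (ae_of_all _ fun w => sq_nonneg _)]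
  refine ENNReal.ofReal_le_ofReal ?_
  have hki := integrable_one_add_abs_rpow_neg_two
  have hkm : Measurable fun u : ℝ => (1 + |u|) ^ (-2 : ℝ) := by fun_prop
  have hkle : ∀ u : ℝ, (1 + |u|) ^ (-2 : ℝ) ≤ 1 := fun u =>
    Real.rpow_le_one_of_one_le_of_nonpos (by linarith [abs_nonneg u]) (by norm_num)
  have hk0 : ∀ u : ℝ, 0 ≤ (1 + |u|) ^ (-2 : ℝ) := fun u => by positivity
  have hk2 : Integrable (fun y : ℝ × ℝ => (1 + |y.1 - y.2|) ^ (-2 : ℝ)) (ν.prod ν) := by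
    refine Integrable.of_bound (C := 1) ?_ (ae_of_all _ fun y => ?_)
    · exact (hkm.comp (measurable_fst.sub measurable_snd)).aestronglyMeasurable
    · rw [Real.norm_of_nonneg (hk0 _)]; exact hkle _
  calc ∫ w, (∫ t, Z t w ∂ν) ^ 2 ∂P
      = ∫ w, ∫ y, Z y.1 w * Z y.2 w ∂(ν.prod ν) ∂P := by simp_rw [hT]
    _ = ∫ y, ∫ w, Z y.1 w * Z y.2 w ∂P ∂(ν.prod ν) := integral_integral_swap hG
    _ ≤ ∫ y, C * (1 + |y.1 - y.2|) ^ (-2 : ℝ) ∂(ν.prod ν) := by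
        refine integral_mono_ae hG.integral_prod_right (hk2.const_mul C) ?_
        rw [hν, Measure.prod_restrict]
        filter_upwards [ae_restrict_mem (measurableSet_Ioc.prod measurableSet_Ioc)] with y hy
        exact hC _ _ hy.1.1.le hy.2.1.le
    _ = C * ∫ t, ∫ s, (1 + |t - s|) ^ (-2 : ℝ) ∂ν ∂ν := by
        rw [integral_const_mul, integral_prod _ hk2]
    _ ≤ C * ∫ _, (∫ u : ℝ, (1 + |u|) ^ (-2 : ℝ)) ∂ν := by
        refine mul_le_mul_of_nonneg_left ?_ hC0
        refine integral_mono hk2.integral_prod_left (integrable_const _) fun t => ?_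
        have h3 := hki.comp_sub_left t
        calc ∫ s, (1 + |t - s|) ^ (-2 : ℝ) ∂ν ≤ ∫ s, (1 + |t - s|) ^ (-2 : ℝ) :=
              setIntegral_le_integral h3 (ae_of_all _ fun s => hk0 _)
          _ = _ := integral_sub_left_eq_self (fun u : ℝ => (1 + |u|) ^ (-2 : ℝ)) volume t
    _ = _ := by
        simp [hν, hN]
        ring

/-- Deterministic interpolation: a general `K` lies between consecutive squares, and the integral
from the lower square to `K` is dominated by the integral of `|F|` over the block. -/
theorem tendsto_average_of_tendsto_squares {F : ℝ → ℝ}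
    (hF : ∀ K, IntegrableOn F (Ioc 1 K))
    (hT : Tendsto (fun j : ℕ => (∫ t in Ioc (1 : ℝ) ((j + 1 : ℝ) ^ 2), F t) / (j + 1 : ℝ) ^ 2)
      atTop (𝓝 0))
    (hD : Tendsto (fun j : ℕ => (∫ t in Ioc ((j + 1 : ℝ) ^ 2) ((j + 2 : ℝ) ^ 2), |F t|) /
      (j + 1 : ℝ) ^ 2) atTop (𝓝 0)) :
    Tendsto (fun K : ℝ => K⁻¹ * ∫ t in K..(2 * K), F t) atTop (𝓝 0) := by
  have hI : ∀ a b, 1 ≤ a → 1 ≤ b → IntervalIntegrable F volume a b := by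
    intro a b ha hb
    rw [intervalIntegrable_iff]
    exact (hF (max a b)).mono_set (Ioc_subset_Ioc_left (le_min ha hb))
  have main : Tendsto (fun K : ℝ => K⁻¹ * ∫ t in (1 : ℝ)..K, F t) atTop (𝓝 0) := by
    -- The shift by one matches the indexing by `(j + 1)²`, so that `(j + 1)² ≤ K ≤ (j + 2)²`.
    have hJ : Tendsto (fun K : ℝ => ⌊√K⌋₊ - 1) atTop atTop :=
      (tendsto_sub_atTop_nat 1).comp (tendsto_nat_floor_atTop.comp Real.tendsto_sqrt_atTop)
    have hlim := ((hT.abs).add hD).comp hJ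
    simp only [abs_zero, add_zero] at hlim
    refine squeeze_zero_norm' ?_ hlim
    filter_upwards [eventually_ge_atTop 1] with K hK
    set j := ⌊√K⌋₊ - 1 with hj
    have hfl : 1 ≤ ⌊√K⌋₊ := by
      rw [Nat.one_le_floor_iff]; exact Real.one_le_sqrt.2 hK
    have hj1 : (j + 1 : ℝ) = ⌊√K⌋₊ := by
      rw [hj]; push_cast [Nat.cast_sub hfl]; ring
    have hlow : (j + 1 : ℝ) ^ 2 ≤ K := by
      rw [hj1]
      calc (⌊√K⌋₊ : ℝ) ^ 2 ≤ √K ^ 2 := by gcongr; exact Nat.floor_le (Real.sqrt_nonneg _)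
        _ = K := Real.sq_sqrt (by linarith)
    have hup : K ≤ (j + 2 : ℝ) ^ 2 := by
      have : (j + 2 : ℝ) = ⌊√K⌋₊ + 1 := by rw [← hj1]; ring
      rw [this]
      calc K = √K ^ 2 := (Real.sq_sqrt (by linarith)).symm
        _ ≤ _ := by gcongr; exact (Nat.lt_floor_add_one _).le
    have h1N : (1 : ℝ) ≤ (j + 1 : ℝ) ^ 2 := by
      have : (0 : ℝ) ≤ j := by positivity
      nlinarith
    have hsplit := intervalIntegral.integral_add_adjacent_intervals (hI 1 _ le_rfl h1N)
      (hI _ K h1N hK)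
    simp only [Function.comp_apply, Real.norm_eq_abs, ← hj]
    rw [abs_mul, abs_of_pos (inv_pos.2 (by linarith : (0 : ℝ) < K)), ← hsplit]
    have hrem : |∫ t in ((j + 1 : ℝ) ^ 2)..K, F t|
        ≤ ∫ t in Ioc ((j + 1 : ℝ) ^ 2) ((j + 2 : ℝ) ^ 2), |F t| := by
      rw [intervalIntegral.integral_of_le hlow]
      refine (abs_integral_le_integral_abs).trans ?_
      refine setIntegral_mono_set ?_ (ae_of_all _ fun t => abs_nonneg _)
        (Ioc_subset_Ioc_right hup).eventuallyLE
      exact ((hF _).mono_set (Ioc_subset_Ioc_left h1N)).abs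
    rw [abs_div, abs_of_pos (by linarith : (0 : ℝ) < (j + 1 : ℝ) ^ 2), ← add_div, inv_mul_eq_div]
    refine div_le_div₀ (by positivity) ?_ (by linarith) hlow
    rw [intervalIntegral.integral_of_le h1N]
    exact (abs_add_le _ _).trans (by gcongr)
  -- The mean over `[K, 2K]` is twice the average up to `2K` minus the average up to `K`.
  have h2 : Tendsto (fun K : ℝ => 2 * ((2 * K)⁻¹ * ∫ t in (1 : ℝ)..(2 * K), F t)) atTop (𝓝 0) := by
    have := (main.comp (tendsto_id.const_mul_atTop (by norm_num : (0 : ℝ) < 2))).const_mul 2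
    simpa using this
  have h3 := h2.sub main
  rw [sub_zero] at h3
  refine h3.congr' ?_
  filter_upwards [eventually_ge_atTop 1] with K hK
  rw [← intervalIntegral.integral_interval_sub_left (hI 1 (2 * K) le_rfl (by linarith))
    (hI 1 K le_rfl hK)]
  field_simp

theorem tendsto_zero_of_enorm_sq_div {x r : ℕ → ℝ} (hr : ∀ j, 0 < r j)
    (h : Tendsto (fun j => ‖x j‖ₑ ^ 2 / ENNReal.ofReal (r j) ^ 2) atTop (𝓝 0)) :
    Tendsto (fun j => x j / r j) atTop (𝓝 0) := by
  have h1 := (ENNReal.tendsto_toReal ENNReal.zero_ne_top).comp h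
  have h2 := (Real.continuous_sqrt.tendsto _).comp h1
  simp only [ENNReal.toReal_zero, Real.sqrt_zero] at h2
  refine squeeze_zero_norm (fun j => le_of_eq ?_) h2
  simp only [Function.comp_apply, ENNReal.toReal_div, ENNReal.toReal_pow, toReal_enorm,
    ENNReal.toReal_ofReal (hr j).le]
  rw [← div_pow, Real.sqrt_sq (div_nonneg (norm_nonneg _) (hr j).le), norm_div,
    Real.norm_of_nonneg (hr j).le]

theorem summable_div_succ_sq (C : ℝ) : Summable fun j : ℕ => C / (j + 1 : ℝ) ^ 2 := by
  have := (summable_nat_add_iff 1).2 (Real.summable_one_div_nat_pow.2 (one_lt_two))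
  simpa [div_eq_mul_inv] using this.mul_left C

/-- If the correlations `E Z_t Z_s` decay like `(1 + |t - s|)⁻²`, then almost surely the averages
of `Z` over `[K, 2K]` tend to zero. -/
theorem ae_tendsto_average_zero (hZ : Measurable (fun p : ℝ × Ω => Z p.1 p.2)) {C : ℝ}
    (hL : ∀ t, 1 ≤ t → MemLp (Z t) 2 P)
    (hC : ∀ t s, 1 ≤ t → 1 ≤ s → ∫ w, Z t w * Z s w ∂P ≤ C * (1 + |t - s|) ^ (-2 : ℝ)) :
    ∀ᵐ w ∂P, (∀ K, IntegrableOn (fun t => Z t w) (Ioc 1 K)) ∧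
      Tendsto (fun K : ℝ => K⁻¹ * ∫ t in K..(2 * K), Z t w) atTop (𝓝 0) := by
  have hM : ∀ t, 1 ≤ t → ∫⁻ w, ‖Z t w‖ₑ ^ 2 ∂P ≤ ENNReal.ofReal C := by
    intro t ht
    have h1 := hC t t ht ht
    simp only [sub_self, abs_zero, add_zero, Real.one_rpow, mul_one] at h1
    have h2 : ∀ w, ‖Z t w‖ₑ ^ 2 = ENNReal.ofReal (Z t w * Z t w) := by
      intro w
      rw [← ofReal_norm, ← ENNReal.ofReal_pow (norm_nonneg _), Real.norm_eq_abs, sq_abs, sq]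
    simp_rw [h2]
    rw [← ofReal_integral_eq_lintegral_ofReal]
    · exact ENNReal.ofReal_le_ofReal h1
    · exact (hL t ht).integrable_mul (hL t ht)
    · exact ae_of_all _ fun w => mul_self_nonneg _
  have hC0 : 0 ≤ C := by
    have h1 := hC 1 1 le_rfl le_rfl
    simp only [sub_self, abs_zero, add_zero, Real.one_rpow, mul_one] at h1
    exact (integral_nonneg fun w => mul_self_nonneg _).trans h1
  have hm : ∀ w, Measurable fun t => Z t w := fun w =>
    Measurable.comp hZ (measurable_prodMk_right (y := w))
  have hsw : Measurable (fun p : Ω × ℝ => Z p.2 p.1) := hZ.comp measurable_swap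
  have hmI : ∀ a b : ℝ, Measurable fun w => ∫⁻ t in Ioc a b, ‖Z t w‖ₑ := fun a b =>
    hsw.enorm.lintegral_prod_right'
  have hmT : ∀ a b : ℝ, Measurable fun w => ∫ t in Ioc a b, Z t w := fun a b =>
    (hsw.stronglyMeasurable.integral_prod_right').measurable
  have hNpos : ∀ j : ℕ, (0 : ℝ) < (j + 1 : ℝ) ^ 2 := fun j => by positivity
  have h1N : ∀ j : ℕ, (1 : ℝ) ≤ (j + 1 : ℝ) ^ 2 := fun j => by
    have : (0 : ℝ) ≤ j := by positivity
    nlinarith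
  have hfin : ∀ᵐ w ∂P, ∀ N : ℕ, ∫⁻ t in Ioc (1 : ℝ) N, ‖Z t w‖ₑ < ⊤ := by
    rw [ae_all_iff]
    intro N
    have h1 := lintegral_sq_lintegral_enorm_le (b := N) hZ hM (le_refl 1)
    have h2 : ∫⁻ w, (∫⁻ t in Ioc (1 : ℝ) N, ‖Z t w‖ₑ) ^ 2 ∂P ≠ ⊤ :=
      (h1.trans_lt (ENNReal.mul_lt_top (ENNReal.pow_lt_top ENNReal.ofReal_lt_top)
        ENNReal.ofReal_lt_top)).ne
    filter_upwards [ae_lt_top ((hmI 1 N).pow_const 2) h2] with w hw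
    by_contra hcon
    rw [not_lt, top_le_iff] at hcon
    simp [hcon] at hw
  set B := ∫ u : ℝ, (1 + |u|) ^ (-2 : ℝ) with hB
  have hB0 : 0 ≤ B := integral_nonneg fun u => by positivity
  -- With `N = (j + 1)²`, the linear bound divided by `N²` is of size `1 / (j + 1)²`, which is
  -- summable.
  have hTlim := ae_tendsto_zero_of_tsum_lintegral_ne_top (P := P)
    (f := fun j w => ‖∫ t in Ioc (1 : ℝ) ((j + 1 : ℝ) ^ 2), Z t w‖ₑ ^ 2 /
      ENNReal.ofReal ((j + 1 : ℝ) ^ 2) ^ 2)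
    (fun j => (((hmT _ _).enorm.pow_const 2).div_const _).aemeasurable) (by
      refine ne_top_of_le_ne_top (summable_div_succ_sq (C * B)).tsum_ofReal_ne_top
        (ENNReal.tsum_le_tsum fun j => ?_)
      simp_rw [div_eq_mul_inv]
      rw [lintegral_mul_const _ ((hmT _ _).enorm.pow_const 2), ← div_eq_mul_inv]
      rw [← ENNReal.ofReal_pow (hNpos j).le]
      refine ENNReal.div_le_of_le_mul ?_
      rw [← ENNReal.ofReal_mul (by positivity)]
      refine (lintegral_sq_integral_le hZ hL hC (h1N j)).trans (ENNReal.ofReal_le_ofReal ?_)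
      rw [← hB]
      calc C * B * ((j + 1 : ℝ) ^ 2 - 1) ≤ C * B * (j + 1 : ℝ) ^ 2 := by
            gcongr; linarith
        _ = _ := by field_simp)
  have hDlim := ae_tendsto_zero_of_tsum_lintegral_ne_top (P := P)
    (f := fun j w => (∫⁻ t in Ioc ((j + 1 : ℝ) ^ 2) ((j + 2 : ℝ) ^ 2), ‖Z t w‖ₑ) ^ 2 /
      ENNReal.ofReal ((j + 1 : ℝ) ^ 2) ^ 2)
    (fun j => (((hmI _ _).pow_const 2).div_const _).aemeasurable) (by
      refine ne_top_of_le_ne_top (summable_div_succ_sq (9 * C)).tsum_ofReal_ne_top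
        (ENNReal.tsum_le_tsum fun j => ?_)
      simp_rw [div_eq_mul_inv]
      rw [lintegral_mul_const _ ((hmI _ _).pow_const 2), ← div_eq_mul_inv]
      rw [← ENNReal.ofReal_pow (hNpos j).le]
      refine ENNReal.div_le_of_le_mul ?_
      rw [← ENNReal.ofReal_mul (by positivity)]
      refine (lintegral_sq_lintegral_enorm_le hZ hM (h1N j)).trans ?_
      have hj : (0 : ℝ) ≤ j := by positivity
      rw [← ENNReal.ofReal_pow (by nlinarith), ← ENNReal.ofReal_mul (by positivity)]
      refine ENNReal.ofReal_le_ofReal ?_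
      -- The block has length `2j + 3 ≤ 3(j + 1)`, so its squared length over `N²` is again
      -- summable.
      have h3 : ((j + 2 : ℝ) ^ 2 - (j + 1 : ℝ) ^ 2) ^ 2 ≤ 9 * (j + 1 : ℝ) ^ 2 := by nlinarith
      calc _ ≤ 9 * (j + 1 : ℝ) ^ 2 * C := by gcongr
        _ = _ := by field_simp)
  filter_upwards [hfin, hTlim, hDlim] with w hw hTw hDw
  have hint : ∀ K, IntegrableOn (fun t => Z t w) (Ioc 1 K) := by
    intro K
    obtain ⟨N, hN⟩ := exists_nat_ge K
    refine IntegrableOn.mono_set ?_ (Ioc_subset_Ioc_right hN)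
    exact ⟨(hm w).aestronglyMeasurable, hw N⟩
  refine ⟨hint, tendsto_average_of_tendsto_squares hint
    (tendsto_zero_of_enorm_sq_div hNpos hTw) (tendsto_zero_of_enorm_sq_div hNpos ?_)⟩
  refine hDw.congr fun j => ?_
  congr 2
  have hij : IntegrableOn (fun t => Z t w) (Ioc ((j + 1 : ℝ) ^ 2) ((j + 2 : ℝ) ^ 2)) :=
    (hint _).mono_set (Ioc_subset_Ioc_left (h1N j))
  rw [Real.enorm_eq_ofReal (integral_nonneg fun t => abs_nonneg _),
    ofReal_integral_eq_lintegral_ofReal hij.abs (ae_of_all _ fun t => abs_nonneg _)]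
  simp_rw [← Real.norm_eq_abs, ofReal_norm]

end

/-! ### Time averages of products of Gaussian processes -/

section

variable {Ω : Type*} [MeasurableSpace Ω] {P : Measure Ω}

/-- Squaring a Gaussian process turns correlation decay of order one, not integrable in itself, into
decay of order two, as the strong law requires. -/
theorem ProbabilityTheory.IsGaussianProcess.ae_tendsto_average_sq {X : ℝ → Ω → ℝ}
    (hX : IsGaussianProcess X P) (hm : ∀ t, Measurable (X t))
    (hc : ∀ᵐ w ∂P, Continuous fun t => X t w) {C : ℝ}
    (hC : ∀ t s, 1 ≤ t → 1 ≤ s → |∫ w, X t w * X s w ∂P| ≤ C * (1 + |t - s|)⁻¹) :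
    ∀ᵐ w ∂P, (∀ K, IntegrableOn (fun t => X t w ^ 2 - ∫ w', X t w' ^ 2 ∂P) (Ioc 1 K)) ∧
      Tendsto (fun K : ℝ => K⁻¹ * ∫ t in K..(2 * K), (X t w ^ 2 - ∫ w', X t w' ^ 2 ∂P))
        atTop (𝓝 0) := by
  have hP := hX.isProbabilityMeasure
  obtain ⟨s, hs, hsm, hsc⟩ := hc.exists_measurable_mem
  -- Setting the process to zero off a measurable set of full measure makes every path continuous,
  -- hence the process jointly measurable.
  set X' : ℝ → Ω → ℝ := fun t => s.indicator (X t) with hX'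
  have hXX' : ∀ t, X t =ᵐ[P] X' t := fun t => by
    filter_upwards [hs] with w hw
    simp [hX', hw]
  have hG : IsGaussianProcess X' P := hX.congr hXX'
  have hcont : ∀ w, Continuous fun t => X' t w := by
    intro w
    by_cases hw : w ∈ s
    · simpa [hX', hw] using hsc w hw
    · simpa [hX', hw] using continuous_const
  have hmeas : ∀ t, Measurable (X' t) := fun t => (hm t).indicator hsm
  have hjoint : Measurable (fun p : ℝ × Ω => X' p.1 p.2) :=
    measurable_uncurry_of_continuous_of_measurable hcont hmeas
  have hr : Measurable fun t => ∫ w, X' t w ^ 2 ∂P :=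
    (hjoint.pow_const 2).stronglyMeasurable.integral_prod_right'.measurable
  have hadd : ∀ t s, HasGaussianLaw (fun w => X' t w + X' s w) P := fun t s =>
    hG.hasGaussianLaw_fun_add
  have hsub : ∀ t s, HasGaussianLaw (fun w => X' t w - X' s w) P := fun t s =>
    hG.hasGaussianLaw_fun_sub
  have hev := fun t => hG.hasGaussianLaw_eval t
  have hi2 : ∀ t, Integrable (fun w => X' t w ^ 2) P := fun t => by
    simpa using (hev t).integrable_pow_mul_pow (hev t) 2 0
  have hi22 := fun t s => (hev t).integrable_pow_mul_pow (hev s) 2 2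
  have main := ae_tendsto_average_zero (P := P) (Z := fun t w => X' t w ^ 2 - ∫ w', X' t w' ^ 2 ∂P)
    (C := 2 * C ^ 2) ((hjoint.pow_const 2).sub (hr.comp measurable_fst)) ?_ ?_
  · have hr' : ∀ t, ∫ w, X t w ^ 2 ∂P = ∫ w, X' t w ^ 2 ∂P := fun t =>
      integral_congr_ae ((hXX' t).fun_comp (· ^ 2))
    filter_upwards [main, hs] with w hw hws
    simpa [hr', hX', hws] using hw
  · intro t _
    refine MemLp.sub ?_ (memLp_const _)
    rw [memLp_two_iff_integrable_sq ((hmeas t).pow_const 2).aestronglyMeasurable]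
    refine (hi22 t t).congr (ae_of_all _ fun w => ?_)
    ring
  · intro t u ht hu
    have e : ∫ w, (X' t w ^ 2 - ∫ w', X' t w' ^ 2 ∂P) * (X' u w ^ 2 - ∫ w', X' u w' ^ 2 ∂P) ∂P
        = (∫ w, X' t w ^ 2 * X' u w ^ 2 ∂P)
          - (∫ w, X' t w ^ 2 ∂P) * ∫ w, X' u w ^ 2 ∂P := by
      set a := ∫ w, X' t w ^ 2 ∂P
      set b := ∫ w, X' u w ^ 2 ∂P
      have : ∀ w, (X' t w ^ 2 - a) * (X' u w ^ 2 - b)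
          = X' t w ^ 2 * X' u w ^ 2 - (b * X' t w ^ 2 + a * X' u w ^ 2 - a * b) := by
        intro w; ring
      simp_rw [this]
      rw [integral_sub (hi22 t u), integral_sub, integral_add, integral_const_mul,
        integral_const_mul, integral_const]
      · simp only [probReal_univ, one_smul]
        ring
      · exact (hi2 t).const_mul b
      · exact (hi2 u).const_mul a
      · exact ((hi2 t).const_mul b).add ((hi2 u).const_mul a)
      · exact integrable_const _
      · exact (((hi2 t).const_mul b).add ((hi2 u).const_mul a)).sub (integrable_const _)
    rw [e]
    have h1 := (hev t).integral_sq_mul_sq_le (hev u) (hadd t u) (hsub t u)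
    have h2 : |∫ w, X' t w * X' u w ∂P| ≤ C * (1 + |t - u|)⁻¹ := by
      have h5 : ∫ w, X t w * X u w ∂P = ∫ w, X' t w * X' u w ∂P :=
        integral_congr_ae ((hXX' t).mul (hXX' u))
      rw [← h5]
      exact hC t u ht hu
    have h3 := sq_le_sq' (neg_le_of_abs_le h2) (le_of_abs_le h2)
    have h4 : (1 + |t - u|) ^ (-2 : ℝ) = ((1 + |t - u|)⁻¹) ^ 2 := by
      rw [Real.rpow_neg (by positivity), inv_pow]
      norm_cast
    rw [h4]
    nlinarith

/-- Polarization `XY = ((X + Y)² - (X - Y)²) / 4` reduces products to squares of the Gaussian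
processes `X ± Y`, whose correlations are bounded by four terms each. -/
theorem ae_tendsto_average_mul {X Y : ℝ → Ω → ℝ}
    (hX : IsGaussianProcess X P) (hY : IsGaussianProcess Y P)
    (ha : IsGaussianProcess (fun t w => X t w + Y t w) P)
    (hs : IsGaussianProcess (fun t w => X t w - Y t w) P)
    (hmX : ∀ t, Measurable (X t)) (hmY : ∀ t, Measurable (Y t))
    (hcX : ∀ᵐ w ∂P, Continuous fun t => X t w) (hcY : ∀ᵐ w ∂P, Continuous fun t => Y t w) {C : ℝ}
    (hXX : ∀ t s, 1 ≤ t → 1 ≤ s → |∫ w, X t w * X s w ∂P| ≤ C * (1 + |t - s|)⁻¹)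
    (hXY : ∀ t s, 1 ≤ t → 1 ≤ s → |∫ w, X t w * Y s w ∂P| ≤ C * (1 + |t - s|)⁻¹)
    (hYY : ∀ t s, 1 ≤ t → 1 ≤ s → |∫ w, Y t w * Y s w ∂P| ≤ C * (1 + |t - s|)⁻¹) :
    ∀ᵐ w ∂P, (∀ K, IntegrableOn (fun t => X t w * Y t w - ∫ w', X t w' * Y t w' ∂P) (Ioc 1 K)) ∧
      Tendsto (fun K : ℝ => K⁻¹ * ∫ t in K..(2 * K), (X t w * Y t w - ∫ w', X t w' * Y t w' ∂P))
        atTop (𝓝 0) := by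
  have hP := hX.isProbabilityMeasure
  have eX := fun t => (hX.hasGaussianLaw_eval t).memLp_two
  have eY := fun t => (hY.hasGaussianLaw_eval t).memLp_two
  have iXX : ∀ t s, Integrable (fun w => X t w * X s w) P := fun t s => (eX t).integrable_mul (eX s)
  have iXY : ∀ t s, Integrable (fun w => X t w * Y s w) P := fun t s => (eX t).integrable_mul (eY s)
  have iYY : ∀ t s, Integrable (fun w => Y t w * Y s w) P := fun t s => (eY t).integrable_mul (eY s)
  have exp_add : ∀ t s, ∫ w, (X t w + Y t w) * (X s w + Y s w) ∂P
      = (∫ w, X t w * X s w ∂P) + (∫ w, X t w * Y s w ∂P) + ((∫ w, X s w * Y t w ∂P)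
        + ∫ w, Y t w * Y s w ∂P) := by
    intro t s
    rw [← integral_add (iXX t s) (iXY t s), ← integral_add (iXY s t) (iYY t s), ← integral_add]
    · congr 1; ext w; ring
    · exact (iXX t s).add (iXY t s)
    · exact (iXY s t).add (iYY t s)
  have exp_sub : ∀ t s, ∫ w, (X t w - Y t w) * (X s w - Y s w) ∂P
      = (∫ w, X t w * X s w ∂P) - (∫ w, X t w * Y s w ∂P) - ((∫ w, X s w * Y t w ∂P)
        - ∫ w, Y t w * Y s w ∂P) := by
    intro t s
    rw [← integral_sub (iXX t s) (iXY t s), ← integral_sub (iXY s t) (iYY t s), ← integral_sub]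
    · congr 1; ext w; ring
    · exact (iXX t s).sub (iXY t s)
    · exact (iXY s t).sub (iYY t s)
  have h1 := ha.ae_tendsto_average_sq (C := 4 * C) (fun t => (hmX t).add (hmY t))
    (by filter_upwards [hcX, hcY] with w h1 h2 using h1.add h2) (by
      intro t s ht hs
      have b1 := abs_le.1 (hXX t s ht hs)
      have b2 := abs_le.1 (hXY t s ht hs)
      have b3 := abs_le.1 (hXY s t hs ht)
      have b4 := abs_le.1 (hYY t s ht hs)
      rw [abs_sub_comm s t] at b3
      rw [exp_add, abs_le]
      constructor <;> linarith [b1.1, b1.2, b2.1, b2.2, b3.1, b3.2, b4.1, b4.2])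
  have h2 := hs.ae_tendsto_average_sq (C := 4 * C) (fun t => (hmX t).sub (hmY t))
    (by filter_upwards [hcX, hcY] with w h1 h2 using h1.sub h2) (by
      intro t s ht hs
      have b1 := abs_le.1 (hXX t s ht hs)
      have b2 := abs_le.1 (hXY t s ht hs)
      have b3 := abs_le.1 (hXY s t hs ht)
      have b4 := abs_le.1 (hYY t s ht hs)
      rw [abs_sub_comm s t] at b3
      rw [exp_sub, abs_le]
      constructor <;> linarith [b1.1, b1.2, b2.1, b2.2, b3.1, b3.2, b4.1, b4.2])
  have hpol : ∀ t w, X t w * Y t w - ∫ w', X t w' * Y t w' ∂P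
      = 4⁻¹ * (((X t w + Y t w) ^ 2 - ∫ w', (X t w' + Y t w') ^ 2 ∂P)
        - ((X t w - Y t w) ^ 2 - ∫ w', (X t w' - Y t w') ^ 2 ∂P)) := by
    intro t w
    have e1 := exp_add t t
    have e2 := exp_sub t t
    simp_rw [sq]
    rw [e1, e2]
    ring
  filter_upwards [h1, h2] with w hw1 hw2
  simp_rw [hpol]
  refine ⟨fun K => ((hw1.1 K).sub (hw2.1 K)).const_mul _, ?_⟩
  have := (hw1.2.sub hw2.2).const_mul 4⁻¹
  simp only [sub_zero, mul_zero] at this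
  refine this.congr' ?_
  filter_upwards [eventually_ge_atTop 1] with K hK
  have hsub : Ioc K (2 * K) ⊆ Ioc 1 (2 * K) := Ioc_subset_Ioc_left hK
  have i1 := (intervalIntegrable_iff_integrableOn_Ioc_of_le (by linarith)).2
    ((hw1.1 _).mono_set hsub)
  have i2 := (intervalIntegrable_iff_integrableOn_Ioc_of_le (by linarith)).2
    ((hw2.1 _).mono_set hsub)
  rw [intervalIntegral.integral_const_mul, intervalIntegral.integral_sub i1 i2]
  ring

end

/-! ### Distributions: supports, pairings, continuity -/

section

variable {n : ℕ}

/-- The product of a test function with a smooth function. -/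
def smoothMul (f : Rn n → ℝ) (hf : ContDiff ℝ ∞ f) (φ : RealTest n) : RealTest n where
  toFun x := f x * φ x
  contDiff' := hf.mul φ.contDiff
  hasCompactSupport' := φ.hasCompactSupport.mul_left
  tsupport_subset' := fun _ _ => trivial

theorem smoothMul_apply (f : Rn n → ℝ) (hf : ContDiff ℝ ∞ f) (φ : RealTest n) (x : Rn n) :
    smoothMul f hf φ x = f x * φ x := rfl

theorem cutoffMul_apply (N : ℕ) (f : Rn n → ℝ) (hf : ContDiff ℝ ∞ f) (x : Rn n) :
    cutoffMul N f hf x = cutoff n N x * f x := rfl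

/-- A linear functional vanishes on every test function whose support avoids its own. -/
theorem apply_eq_zero_of_disjoint_dsupport (v : RealTest n →ₗ[ℝ] ℝ) (φ : RealTest n)
    (h : Disjoint (tsupport φ) (Distribution.dsupport v)) : v φ = 0 := by
  -- Compactness glues local cutoffs that `v` annihilates after multiplication by any test function.
  -- The union step uses `1 - (1 - f)(1 - g)`, so neither a partition of unity nor continuity of `v`
  -- is needed.
  have key : ∃ (f : Rn n → ℝ) (hf : ContDiff ℝ ∞ f), (∀ x ∈ tsupport φ, f x = 1) ∧
      ∀ ψ, v (smoothMul f hf ψ) = 0 := by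
    refine IsCompact.induction_on (s := tsupport φ) φ.hasCompactSupport
      (p := fun s => ∃ (f : Rn n → ℝ) (hf : ContDiff ℝ ∞ f), (∀ x ∈ s, f x = 1) ∧
        ∀ ψ, v (smoothMul f hf ψ) = 0) ?_ ?_ ?_ ?_
    · refine ⟨0, contDiff_const, by simp, fun ψ => ?_⟩
      convert map_zero v
      ext x
      simp [smoothMul_apply]
    · rintro s t hst ⟨f, hf, h1, h2⟩
      exact ⟨f, hf, fun x hx => h1 x (hst hx), h2⟩
    · rintro s t ⟨f, hf, h1, h2⟩ ⟨g, hg, h3, h4⟩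
      refine ⟨fun x => f x + g x - f x * g x, (hf.add hg).sub (hf.mul hg), ?_, fun ψ => ?_⟩
      · rintro x (hx | hx)
        · simp [h1 x hx]
        · simp [h3 x hx]
      · have : smoothMul (fun x => f x + g x - f x * g x) ((hf.add hg).sub (hf.mul hg)) ψ
            = smoothMul f hf ψ + smoothMul g hg ψ - smoothMul f hf (smoothMul g hg ψ) := by
          ext x
          simp [smoothMul_apply]
          ring
        rw [this, map_sub, map_add, h2, h4, h2]
        simp
    · intro x hx
      have hx' : x ∉ Distribution.dsupport v := fun hx' => h.le_bot ⟨hx, hx'⟩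
      rw [Distribution.notMem_dsupport_iff] at hx'
      obtain ⟨U, hU, hUo, hxU⟩ := hx'
      obtain ⟨ε, hε, hεU⟩ := Metric.nhds_basis_closedBall.mem_iff.1 (hUo.mem_nhds hxU)
      let b : ContDiffBump x := ⟨ε / 2, ε, by positivity, by linarith⟩
      refine ⟨Metric.closedBall x (ε / 2), mem_nhdsWithin_of_mem_nhds
        (Metric.closedBall_mem_nhds x (by positivity)), b, b.contDiff, fun y hy =>
        b.one_of_mem_closedBall hy, fun ψ => hU _ ?_⟩
      refine (tsupport_mul_subset_left (f := b) (g := ψ)).trans ?_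
      rw [b.tsupport_eq]
      exact hεU
  obtain ⟨f, hf, h1, h2⟩ := key
  convert h2 φ
  ext x
  rw [smoothMul_apply]
  by_cases hx : x ∈ tsupport φ
  · rw [h1 x hx, one_mul]
  · rw [image_eq_zero_of_notMem_tsupport hx, mul_zero]

theorem cutoff_eq_one {N : ℕ} {x : Rn n} (hx : ‖x‖ ≤ N + 1) : cutoff n N x = 1 :=
  (cutoff n N).one_of_mem_closedBall (by simpa [cutoff] using hx)

theorem apply_cutoffMul_eq {v : RealTest n →ₗ[ℝ] ℝ} {N₀ N : ℕ}
    (hv : Distribution.dsupport v ⊆ Metric.closedBall 0 N₀) (hN : N₀ ≤ N) (f : Rn n → ℝ)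
    (hf : ContDiff ℝ ∞ f) : v (cutoffMul N f hf) = v (cutoffMul N₀ f hf) := by
  rw [← sub_eq_zero, ← map_sub]
  refine apply_eq_zero_of_disjoint_dsupport v _ (Disjoint.mono_right hv ?_)
  rw [Set.disjoint_left]
  intro x hx hx'
  rw [Metric.mem_closedBall, dist_zero_right] at hx'
  -- Both cutoffs equal one on this open ball, so their difference is supported away from the closed
  -- ball of radius `N₀` containing the support of `v`.
  have hmem : x ∈ Metric.ball (0 : Rn n) (N₀ + 1) := by
    rw [Metric.mem_ball, dist_zero_right]; linarith
  rw [tsupport, mem_closure_iff] at hx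
  obtain ⟨y, hy, hy'⟩ := hx _ Metric.isOpen_ball hmem
  rw [Metric.mem_ball, dist_zero_right] at hy
  refine hy' ?_
  have hNN : (N₀ : ℝ) ≤ N := by exact_mod_cast hN
  rw [sub_apply, cutoffMul_apply, cutoffMul_apply, cutoff_eq_one hy.le,
    cutoff_eq_one (by linarith), sub_self]

theorem realPairing_eq {v : RealTest n →ₗ[ℝ] ℝ} {N : ℕ}
    (hv : Distribution.dsupport v ⊆ Metric.closedBall 0 N) (f : Rn n → ℝ)
    (hf : ContDiff ℝ ∞ f) : realPairing v f hf = v (cutoffMul N f hf) := by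
  refine Tendsto.limUnder_eq (tendsto_const_nhds.congr' ?_)
  filter_upwards [eventually_ge_atTop N] with M hM
  exact (apply_cutoffMul_eq hv hM f hf).symm

/-- The test function `χ_N cos(ζ · y)`. -/
def cosTest (N : ℕ) (ζ : Rn n) : RealTest n :=
  cutoffMul N (fun x => (planeWave ζ x).re) (Complex.reCLM.contDiff.comp (contDiff_planeWave ζ))

/-- The test function `χ_N sin(ζ · y)`. -/
def sinTest (N : ℕ) (ζ : Rn n) : RealTest n :=
  cutoffMul N (fun x => (planeWave ζ x).im) (Complex.imCLM.contDiff.comp (contDiff_planeWave ζ))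

theorem planeWave_add (ζ ζ' x : Rn n) : planeWave (ζ + ζ') x = planeWave ζ x * planeWave ζ' x := by
  simp only [planeWave, inner_add_left, ← Complex.exp_add]
  congr 1
  push_cast
  ring

theorem planeWave_neg (ζ x : Rn n) : planeWave (-ζ) x = (starRingEnd ℂ) (planeWave ζ x) := by
  simp [planeWave, ← Complex.exp_conj]

theorem norm_planeWave (ζ x : Rn n) : ‖planeWave ζ x‖ = 1 := by
  rw [planeWave, mul_comm, Complex.norm_exp_ofReal_mul_I]

theorem complexPairing_congr (v : RealTest n →ₗ[ℝ] ℝ) {f g : Rn n → ℂ} (hf : ContDiff ℝ ∞ f)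
    (hg : ContDiff ℝ ∞ g) (h : f = g) : complexPairing v f hf = complexPairing v g hg := by
  subst h; rfl

theorem bornFarField_eq {v : RealTest n →ₗ[ℝ] ℝ} {N : ℕ}
    (hv : Distribution.dsupport v ⊆ Metric.closedBall 0 N) (cn : ℂ) (k : ℝ) (θ : Rn n) :
    bornFarField cn v k θ (-θ)
      = cn * ((v (cosTest N ((2 * k) • θ)) : ℂ) + Complex.I * (v (sinTest N ((2 * k) • θ)) : ℂ)) := by
  have h : (fun y => planeWave (-(k • -θ)) y * planeWave (k • θ) y) = planeWave ((2 * k) • θ) := by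
    ext y
    rw [← planeWave_add]
    congr 1
    rw [smul_neg, neg_neg, ← add_smul, two_mul]
  rw [bornFarField, complexPairing_congr v _ (contDiff_planeWave ((2 * k) • θ)) h]
  refine congrArg (cn * ·) (congrArg₂ (fun a b : ℝ => (a : ℂ) + Complex.I * b) ?_ ?_)
  · exact realPairing_eq hv _ _
  · exact realPairing_eq hv _ _

theorem cosTest_apply (N : ℕ) (ζ x : Rn n) :
    cosTest N ζ x = cutoff n N x * (planeWave ζ x).re := rfl

theorem sinTest_apply (N : ℕ) (ζ x : Rn n) :
    sinTest N ζ x = cutoff n N x * (planeWave ζ x).im := rfl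

theorem cosTest_neg (N : ℕ) (ζ : Rn n) : cosTest N (-ζ) = cosTest N ζ := by
  ext x
  simp [cosTest_apply, planeWave_neg]

theorem sinTest_neg (N : ℕ) (ζ : Rn n) : sinTest N (-ζ) = -sinTest N ζ := by
  ext x
  simp [sinTest_apply, planeWave_neg]

/-- Continuity in the parameter of the pairing with a smooth family of test functions. -/
theorem continuous_apply_cutoffMul {v : RealTest n →ₗ[ℝ] ℝ} {N M : ℕ} {C : ℝ}
    (hv : ∀ φ : RealTest n, tsupport φ ⊆ Metric.closedBall 0 (N + 2) →
      |v φ| ≤ C * ∑ i ∈ Finset.range (M + 1), ⨆ x : Rn n, ‖iteratedFDeriv ℝ i φ x‖)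
    {E : Type*} [NormedAddCommGroup E] [NormedSpace ℝ E] {F : E → Rn n → ℝ}
    (hF : ContDiff ℝ ∞ fun p : E × Rn n => F p.1 p.2) (hF' : ∀ t, ContDiff ℝ ∞ (F t)) :
    Continuous fun t => v (cutoffMul N (F t) (hF' t)) := by
  set G : E × Rn n → ℝ := fun p => cutoff n N p.2 * F p.1 p.2 with hGdef
  have hG : ContDiff ℝ ∞ G := ((cutoff n N).contDiff.comp contDiff_snd).mul hF
  have hsupp : ∀ t, tsupport (cutoffMul N (F t) (hF' t)) ⊆ Metric.closedBall 0 (N + 2) := fun t =>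
    (tsupport_mul_subset_left (f := cutoff n N)).trans (cutoff n N).tsupport_eq.subset
  -- Derivatives in `x` alone are joint derivatives of `G` restricted to the second factor, hence
  -- jointly continuous. Compactness of the cutoff's support then gives uniform convergence in `x`.
  have hder : ∀ (i : ℕ) (t : E) (x : Rn n), iteratedFDeriv ℝ i (cutoffMul N (F t) (hF' t)) x
      = ContinuousMultilinearMap.compContinuousLinearMapL
        (fun _ => ContinuousLinearMap.inr ℝ E (Rn n)) (iteratedFDeriv ℝ i G (t, x)) := by
    intro i t x
    have h1 : (cutoffMul N (F t) (hF' t) : Rn n → ℝ)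
        = (fun y => G ((t, 0) + y)) ∘ ContinuousLinearMap.inr ℝ E (Rn n) := by
      ext y
      simp [hGdef, cutoffMul_apply]
    have h2 : ContDiff ℝ ∞ fun y : E × Rn n => G ((t, 0) + y) := hG.comp (by fun_prop)
    rw [h1, ContinuousLinearMap.iteratedFDeriv_comp_right _ h2 x (mod_cast le_top),
      iteratedFDeriv_comp_add_left]
    simp
  have hcont : ∀ i, Continuous fun p : E × Rn n =>
      iteratedFDeriv ℝ i (cutoffMul N (F p.1) (hF' p.1)) p.2 := by
    intro i
    simp_rw [hder]
    exact (ContinuousLinearMap.continuous _).comp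
      (hG.continuous_iteratedFDeriv (mod_cast le_top))
  rw [continuous_iff_continuousAt]
  intro s
  have hsup : ∀ i, Tendsto (fun t => ⨆ x, ‖iteratedFDeriv ℝ i
      (cutoffMul N (F t) (hF' t) - cutoffMul N (F s) (hF' s) : RealTest n) x‖) (𝓝 s) (𝓝 0) := by
    intro i
    rw [Metric.tendsto_nhds]
    intro ε hε
    have hK := (isCompact_closedBall (0 : Rn n) (N + 2)).eventually_forall_of_forall_eventually
      (x₀ := s) (P := fun t x => ‖iteratedFDeriv ℝ i (cutoffMul N (F t) (hF' t)) x
        - iteratedFDeriv ℝ i (cutoffMul N (F s) (hF' s)) x‖ < ε / 2) (by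
      intro x _
      have hc : Continuous fun z : E × Rn n =>
          ‖iteratedFDeriv ℝ i (cutoffMul N (F z.1) (hF' z.1)) z.2
            - iteratedFDeriv ℝ i (cutoffMul N (F s) (hF' s)) z.2‖ :=
        ((hcont i).sub ((hcont i).comp (by fun_prop : Continuous fun z : E × Rn n =>
          ((s, z.2) : E × Rn n)))).norm
      refine hc.continuousAt.eventually (Iio_mem_nhds ?_)
      simpa using half_pos hε)
    filter_upwards [hK] with t ht
    have h0 : 0 ≤ ⨆ x, ‖iteratedFDeriv ℝ i
      (cutoffMul N (F t) (hF' t) - cutoffMul N (F s) (hF' s) : RealTest n) x‖ :=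
      Real.iSup_nonneg fun x => norm_nonneg _
    rw [Real.dist_0_eq_abs, abs_of_nonneg h0]
    refine lt_of_le_of_lt (Real.iSup_le (fun x => ?_) (half_pos hε).le) (half_lt_self hε)
    have hsub : iteratedFDeriv ℝ i
        (cutoffMul N (F t) (hF' t) - cutoffMul N (F s) (hF' s) : RealTest n) x
        = iteratedFDeriv ℝ i (cutoffMul N (F t) (hF' t)) x
          - iteratedFDeriv ℝ i (cutoffMul N (F s) (hF' s)) x := by
      rw [FunLike.coe_sub, iteratedFDeriv_sub_apply]
      · exact ((cutoffMul N (F t) (hF' t)).contDiff.of_le (mod_cast le_top)).contDiffAt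
      · exact ((cutoffMul N (F s) (hF' s)).contDiff.of_le (mod_cast le_top)).contDiffAt
    rw [hsub]
    by_cases hx : x ∈ Metric.closedBall (0 : Rn n) (N + 2)
    · exact (ht x hx).le
    · have hz : ∀ u, iteratedFDeriv ℝ i (cutoffMul N (F u) (hF' u)) x = 0 := fun u => by
        by_contra hne
        exact hx (hsupp u (support_iteratedFDeriv_subset i hne))
      rw [hz, hz, sub_self, norm_zero]
      exact (half_pos hε).le
  have hsum := (tendsto_finsetSum (Finset.range (M + 1)) fun i _ => hsup i).const_mul C
  simp only [Finset.sum_const_zero, mul_zero] at hsum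
  rw [ContinuousAt, tendsto_iff_norm_sub_tendsto_zero]
  refine squeeze_zero (fun t => norm_nonneg _) (fun t => ?_) hsum
  rw [← map_sub, Real.norm_eq_abs]
  refine hv _ ((tsupport_sub _ _).trans (union_subset (hsupp t) (hsupp s)))

theorem contDiff_planeWave_uncurry : ContDiff ℝ ∞ fun p : Rn n × Rn n => planeWave p.1 p.2 := by
  unfold planeWave
  exact Complex.contDiff_exp.comp (contDiff_const.mul
    (Complex.ofRealCLM.contDiff.comp (contDiff_fst.inner ℝ contDiff_snd)))

end

/-! ### Pseudodifferential operators applied to modulated test functions -/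

section

open scoped FourierTransform SchwartzMap

variable {n : ℕ}

theorem fourier_eq_integral_planeWave (F : Rn n → ℂ) (w : Rn n) :
    𝓕 F w = ∫ y, planeWave (-((2 * Real.pi) • w)) y * F y := by
  rw [Real.fourier_eq']
  congr 1
  ext y
  rw [smul_eq_mul, planeWave, inner_neg_left, real_inner_smul_left, real_inner_comm, mul_comm Complex.I]
  congr 3
  push_cast
  ring

theorem fourierInv_eq_integral_planeWave (F : Rn n → ℂ) (x : Rn n) :
    𝓕⁻ F x = ∫ w, planeWave ((2 * Real.pi) • w) x * F w := by
  rw [Real.fourierInv_eq']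
  congr 1
  ext y
  rw [smul_eq_mul, planeWave, real_inner_smul_left, mul_comm Complex.I]

theorem integral_mul_planeWave_eq_fourier (F : Rn n → ℂ) (ζ : Rn n) :
    ∫ y, F y * planeWave ζ y = 𝓕 F (-((2 * Real.pi)⁻¹ • ζ)) := by
  rw [fourier_eq_integral_planeWave]
  simp_rw [smul_neg, neg_neg, smul_smul, mul_inv_cancel₀ Real.two_pi_pos.ne', one_smul, mul_comm]

theorem fourier_mul_planeWave (F : Rn n → ℂ) (ζ w : Rn n) :
    𝓕 (fun y => F y * planeWave ζ y) w = 𝓕 F (w - (2 * Real.pi)⁻¹ • ζ) := by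
  rw [fourier_eq_integral_planeWave, fourier_eq_integral_planeWave]
  congr 1
  ext y
  rw [mul_comm (F y), ← mul_assoc, ← planeWave_add]
  congr 2
  rw [smul_sub, smul_smul, mul_inv_cancel₀ Real.two_pi_pos.ne', one_smul]
  abel

/-- The pseudodifferential operator with symbol `c`, written with the Fourier transform. -/
def symbolOp (c : Rn n → Rn n → ℂ) (F : Rn n → ℂ) (x : Rn n) : ℂ :=
  ∫ w, planeWave ((2 * Real.pi) • w) x * c x ((2 * Real.pi) • w) * 𝓕 F w

theorem planeWave_sub_right (ξ x y : Rn n) :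
    planeWave ξ (x - y) = planeWave ξ x * planeWave (-ξ) y := by
  simp only [planeWave, inner_sub_right, inner_neg_left, ← Complex.exp_add]
  congr 1
  push_cast
  ring

/-- The substitution `ξ = 2πw` absorbs the factor `(2π)^(-n)`. -/
theorem pseudoOp_eq_symbolOp (c : Rn n → Rn n → ℂ) (φ : Rn n → ℝ) (x : Rn n) :
    pseudoOp c φ x = symbolOp c (fun y => (φ y : ℂ)) x := by
  have h1 : ∀ ξ, ∫ y : Rn n, planeWave ξ (x - y) * c x ξ * ((φ y : ℝ) : ℂ)
      = planeWave ξ x * c x ξ * ∫ y, planeWave (-ξ) y * (φ y : ℂ) := by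
    intro ξ
    rw [← integral_const_mul]
    congr 1
    ext y
    rw [planeWave_sub_right]
    ring
  have h2 := Measure.integral_comp_smul_of_nonneg (volume : Measure (Rn n))
    (fun ξ => planeWave ξ x * c x ξ * ∫ y, planeWave (-ξ) y * (φ y : ℂ)) (2 * Real.pi)
    (hR := Real.two_pi_pos.le)
  rw [pseudoOp, symbolOp]
  simp_rw [h1, fourier_eq_integral_planeWave]
  rw [h2, finrank_euclideanSpace_fin, Complex.real_smul]
  push_cast
  rfl

theorem SchwartzMap.integrable_one_add_smul_pow_mul (S : 𝓢(Rn n, ℂ)) (k : ℕ) :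
    Integrable fun w => (1 + ‖(2 * Real.pi) • w‖) ^ k * ‖S w‖ := by
  have h0 : Integrable fun w => (2 : ℝ) ^ (k - 1) * (‖S w‖
      + (2 * Real.pi) ^ k * (‖w‖ ^ k * ‖S w‖)) :=
    (S.integrable.norm.add ((S.integrable_pow_mul volume k).const_mul _)).const_mul _
  refine h0.mono' ?_ (ae_of_all _ fun w => ?_)
  · exact Continuous.aestronglyMeasurable (by fun_prop)
  · rw [Real.norm_of_nonneg (by positivity)]
    have := add_pow_le (zero_le_one) (norm_nonneg ((2 * Real.pi) • w)) k
    rw [one_pow, norm_smul, Real.norm_of_nonneg Real.two_pi_pos.le, mul_pow] at this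
    rw [norm_smul, Real.norm_of_nonneg Real.two_pi_pos.le]
    calc _ ≤ 2 ^ (k - 1) * (1 + (2 * Real.pi) ^ k * ‖w‖ ^ k) * ‖S w‖ := by gcongr
      _ = _ := by ring

/-- Fourier–Laplace decay of compactly supported densities. -/
theorem SchwartzMap.exists_norm_integral_mul_planeWave_le (S : 𝓢(Rn n, ℂ)) (k : ℕ) :
    ∃ C : ℝ, 0 ≤ C ∧ ∀ ζ, ‖∫ y, S y * planeWave ζ y‖ ≤ C * ((1 + ‖ζ‖) ^ k)⁻¹ := by
  set A : ℝ := 2 ^ k * (Finset.Iic (k, 0)).sup (fun m => SchwartzMap.seminorm ℂ m.1 m.2) (𝓕 S)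
  have hA : ∀ x, (1 + ‖x‖) ^ k * ‖𝓕 S x‖ ≤ A := fun x => by
    have := SchwartzMap.one_add_le_sup_seminorm_apply (𝕜 := ℂ) (m := (k, 0)) (le_refl k) le_rfl
      (𝓕 S) x
    simpa using this
  have hA0 : 0 ≤ A := le_trans (by positivity) (hA 0)
  refine ⟨(2 * Real.pi) ^ k * A, by positivity, fun ζ => ?_⟩
  have h1 := hA (-((2 * Real.pi)⁻¹ • ζ))
  rw [norm_neg, norm_smul, Real.norm_of_nonneg (inv_nonneg.2 Real.two_pi_pos.le)] at h1
  rw [integral_mul_planeWave_eq_fourier, ← SchwartzMap.fourier_coe, ← div_eq_mul_inv,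
    le_div_iff₀ (by positivity)]
  have h2 : 1 + ‖ζ‖ ≤ (2 * Real.pi) * (1 + (2 * Real.pi)⁻¹ * ‖ζ‖) := by
    rw [mul_add, ← mul_assoc, mul_inv_cancel₀ Real.two_pi_pos.ne']
    linarith [Real.pi_gt_three]
  calc _ ≤ ‖𝓕 S (-((2 * Real.pi)⁻¹ • ζ))‖
        * ((2 * Real.pi) * (1 + (2 * Real.pi)⁻¹ * ‖ζ‖)) ^ k := by gcongr
    _ = (2 * Real.pi) ^ k * ((1 + (2 * Real.pi)⁻¹ * ‖ζ‖) ^ k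
        * ‖𝓕 S (-((2 * Real.pi)⁻¹ • ζ))‖) := by rw [mul_pow]; ring
    _ ≤ _ := by gcongr

/-- The symbol estimates used below: boundedness and decay of the first derivative in `ξ`. -/
structure IsTameSymbol (p : ℝ) (c : Rn n → Rn n → ℂ) (C : ℝ) : Prop where
  continuous : Continuous fun z : Rn n × Rn n => c z.1 z.2
  differentiable : ∀ x, Differentiable ℝ (c x)
  bound : ∀ x ξ, ‖c x ξ‖ ≤ C
  fderiv_bound : ∀ x ξ, ‖fderiv ℝ (c x) ξ‖ ≤ C * (1 + ‖ξ‖) ^ (-p)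

theorem IsTameSymbol.nonneg {p C : ℝ} {c : Rn n → Rn n → ℂ} (h : IsTameSymbol p c C) : 0 ≤ C :=
  (norm_nonneg _).trans (h.bound 0 0)

/-- Mean value inequality along the segment from `ζ` to `η + ζ`, with Peetre's inequality moving the
decay from the intermediate point to `ζ` at the price of a power of `1 + ‖η‖`. -/
theorem IsTameSymbol.norm_sub_le {p C : ℝ} {c : Rn n → Rn n → ℂ} (h : IsTameSymbol p c C)
    (hp : 0 ≤ p) (x ζ η : Rn n) :
    ‖c x (η + ζ) - c x ζ‖ ≤ C * (1 + ‖ζ‖) ^ (-p) * ((1 + ‖η‖) ^ p * ‖η‖) := by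
  have hC := h.nonneg
  have := (convex_segment (𝕜 := ℝ) ζ (η + ζ)).norm_image_sub_le_of_norm_fderiv_le
    (f := c x) (𝕜 := ℝ) (C := C * ((1 + ‖ζ‖) ^ (-p) * (1 + ‖η‖) ^ p))
    (fun y _ => h.differentiable x y) (fun y hy => ?_) (left_mem_segment ℝ ζ (η + ζ))
    (right_mem_segment ℝ ζ (η + ζ))
  · rw [add_sub_cancel_right] at this
    calc _ ≤ _ := this
      _ = _ := by ring
  · refine (h.fderiv_bound x y).trans (mul_le_mul_of_nonneg_left ?_ hC)
    rw [segment_eq_image'] at hy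
    obtain ⟨s, hs, rfl⟩ := hy
    simp only [add_sub_cancel_right]
    have h1 : ‖ζ‖ ≤ ‖ζ + s • η‖ + ‖η‖ := by
      calc ‖ζ‖ = ‖(ζ + s • η) - s • η‖ := by rw [add_sub_cancel_right]
        _ ≤ ‖ζ + s • η‖ + ‖s • η‖ := _root_.norm_sub_le _ _
        _ ≤ _ := by
          rw [norm_smul, Real.norm_of_nonneg hs.1]
          have := mul_le_mul_of_nonneg_right hs.2 (norm_nonneg η)
          linarith
    have h2 : 1 + ‖ζ‖ ≤ (1 + ‖ζ + s • η‖) * (1 + ‖η‖) := by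
      nlinarith [norm_nonneg (ζ + s • η), norm_nonneg η]
    have h3 := Real.rpow_le_rpow (by positivity) h2 hp
    rw [Real.mul_rpow (by positivity) (by positivity)] at h3
    rw [Real.rpow_neg (by positivity), Real.rpow_neg (by positivity), inv_mul_eq_div,
      le_div_iff₀ (by positivity), inv_mul_le_iff₀ (by positivity)]
    exact h3

theorem continuous_planeWave_uncurry : Continuous fun z : Rn n × Rn n => planeWave z.1 z.2 :=
  contDiff_planeWave_uncurry.continuous

theorem continuous_planeWave (ζ : Rn n) : Continuous (planeWave ζ) :=
  (contDiff_planeWave ζ).continuous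

theorem IsTameSymbol.integrable_symbolOp {p C : ℝ} {c : Rn n → Rn n → ℂ} (h : IsTameSymbol p c C)
    (S : 𝓢(Rn n, ℂ)) (x : Rn n) (ζ : Rn n) :
    Integrable fun w => planeWave ((2 * Real.pi) • w + ζ) x * c x ((2 * Real.pi) • w + ζ)
      * S w := by
  refine (S.integrable.norm.const_mul C).mono' ?_ (ae_of_all _ fun w => ?_)
  · refine Continuous.aestronglyMeasurable ((Continuous.mul ?_ ?_).mul S.continuous)
    · exact continuous_planeWave_uncurry.comp (f := fun w => ((2 * Real.pi) • w + ζ, x))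
        (by fun_prop)
    · exact h.continuous.comp (f := fun w => (x, (2 * Real.pi) • w + ζ)) (by fun_prop)
  · rw [norm_mul, norm_mul, norm_planeWave, one_mul]
    exact mul_le_mul_of_nonneg_right (h.bound _ _) (norm_nonneg _)

theorem IsTameSymbol.symbolOp_add_smul {p C : ℝ} {c : Rn n → Rn n → ℂ} (h : IsTameSymbol p c C)
    (S T : 𝓢(Rn n, ℂ)) (z : ℂ) (x : Rn n) :
    symbolOp c (fun y => S y + z * T y) x = symbolOp c S x + z * symbolOp c T x := by
  have hS := h.integrable_symbolOp (𝓕 S) x 0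
  have hT := h.integrable_symbolOp (𝓕 T) x 0
  simp only [add_zero] at hS hT
  have e : (fun y => S y + z * T y) = ((S + z • T : 𝓢(Rn n, ℂ)) : Rn n → ℂ) := by
    ext y; simp
  rw [e, symbolOp, symbolOp, symbolOp, ← integral_const_mul, ← SchwartzMap.fourier_coe,
    ← SchwartzMap.fourier_coe, ← SchwartzMap.fourier_coe, ← integral_add hS (hT.const_mul z)]
  congr 1
  ext w
  rw [FourierTransform.fourier_add, FourierTransform.fourier_smul]
  simp
  ring

theorem IsTameSymbol.norm_symbolOp_le {p C : ℝ} {c : Rn n → Rn n → ℂ} (h : IsTameSymbol p c C)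
    (S : 𝓢(Rn n, ℂ)) (x : Rn n) : ‖symbolOp c S x‖ ≤ C * ∫ w, ‖𝓕 S w‖ := by
  rw [symbolOp, ← SchwartzMap.fourier_coe, ← integral_const_mul]
  refine norm_integral_le_of_norm_le ((𝓕 S).integrable.norm.const_mul C) (ae_of_all _ fun w => ?_)
  rw [norm_mul, norm_mul, norm_planeWave, one_mul]
  exact mul_le_mul_of_nonneg_right (h.bound _ _) (norm_nonneg _)

theorem IsTameSymbol.aestronglyMeasurable_symbolOp {p C : ℝ} {c : Rn n → Rn n → ℂ}
    (h : IsTameSymbol p c C) (S : 𝓢(Rn n, ℂ)) :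
    AEStronglyMeasurable (symbolOp c S) volume := by
  have hc : Continuous fun z : Rn n × Rn n => planeWave ((2 * Real.pi) • z.2) z.1
      * c z.1 ((2 * Real.pi) • z.2) * 𝓕 S z.2 := by
    refine (Continuous.mul ?_ ?_).mul ((𝓕 S).continuous.comp continuous_snd)
    · exact continuous_planeWave_uncurry.comp
        (f := fun z : Rn n × Rn n => ((2 * Real.pi) • z.2, z.1)) (by fun_prop)
    · exact h.continuous.comp
        (f := fun z : Rn n × Rn n => (z.1, (2 * Real.pi) • z.2)) (by fun_prop)
  exact (hc.stronglyMeasurable.integral_prod_right').aestronglyMeasurable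

theorem IsTameSymbol.integrable_symbolOp_mul {p C : ℝ} {c : Rn n → Rn n → ℂ}
    (h : IsTameSymbol p c C) (S T : 𝓢(Rn n, ℂ)) :
    Integrable fun x => symbolOp c S x * T x :=
  T.integrable.bdd_mul (h.aestronglyMeasurable_symbolOp S)
    (ae_of_all _ fun x => h.norm_symbolOp_le S x)

/-- The operator acts on a modulated test function, to leading order, by multiplication with the
symbol evaluated at the frequency. -/
theorem IsTameSymbol.exists_norm_symbolOp_mul_planeWave_sub_le {p C : ℝ} {c : Rn n → Rn n → ℂ}
    (h : IsTameSymbol p c C) (hp : 0 ≤ p) (S : 𝓢(Rn n, ℂ)) :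
    ∃ A : ℝ, ∀ ζ x, ‖symbolOp c (fun y => S y * planeWave ζ y) x - planeWave ζ x * c x ζ * S x‖
      ≤ A * (1 + ‖ζ‖) ^ (-p) := by
  obtain ⟨k, hk⟩ := exists_nat_ge p
  refine ⟨C * ∫ w, (1 + ‖(2 * Real.pi) • w‖) ^ (k + 1) * ‖𝓕 S w‖, fun ζ x => ?_⟩
  -- Modulation translates the Fourier transform, so the symbol is sampled at `2πw + ζ`. Freezing it
  -- at `ζ` costs a power of `‖w‖`, which the Schwartz decay of `𝓕 S` absorbs.
  have e1 : symbolOp c (fun y => S y * planeWave ζ y) x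
      = ∫ w, planeWave ((2 * Real.pi) • w + ζ) x * c x ((2 * Real.pi) • w + ζ) * 𝓕 S w := by
    rw [symbolOp, ← integral_add_right_eq_self _ ((2 * Real.pi)⁻¹ • ζ)]
    congr 1
    ext w
    rw [fourier_mul_planeWave, add_sub_cancel_right, smul_add, smul_smul,
      mul_inv_cancel₀ Real.two_pi_pos.ne', one_smul, SchwartzMap.fourier_coe]
  have e2 : planeWave ζ x * c x ζ * S x
      = ∫ w, planeWave ((2 * Real.pi) • w + ζ) x * c x ζ * 𝓕 S w := by
    have : S x = ∫ w, planeWave ((2 * Real.pi) • w) x * 𝓕 S w := by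
      rw [← fourierInv_eq_integral_planeWave, ← SchwartzMap.fourierInv_coe,
        FourierTransform.fourierInv_fourier_eq]
    rw [this, ← integral_const_mul]
    congr 1
    ext w
    rw [planeWave_add]
    ring
  have i1 := h.integrable_symbolOp (𝓕 S) x ζ
  have i2 : Integrable fun w => planeWave ((2 * Real.pi) • w + ζ) x * c x ζ * 𝓕 S w := by
    refine ((𝓕 S).integrable.norm.const_mul C).mono' ?_ (ae_of_all _ fun w => ?_)
    · refine Continuous.aestronglyMeasurable ((Continuous.mul ?_ continuous_const).mul
        (𝓕 S).continuous)
      exact continuous_planeWave_uncurry.comp (f := fun w => ((2 * Real.pi) • w + ζ, x))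
        (by fun_prop)
    · rw [norm_mul, norm_mul, norm_planeWave, one_mul]
      exact mul_le_mul_of_nonneg_right (h.bound _ _) (norm_nonneg _)
  have i3 := ((𝓕 S).integrable_one_add_smul_pow_mul (k + 1)).const_mul (C * (1 + ‖ζ‖) ^ (-p))
  rw [e1, e2, ← integral_sub i1 i2, mul_right_comm, ← integral_const_mul]
  refine norm_integral_le_of_norm_le i3 (ae_of_all _ fun w => ?_)
  rw [← sub_mul, ← mul_sub, norm_mul, norm_mul, norm_planeWave, one_mul]
  have hC := h.nonneg
  have h1 := h.norm_sub_le hp x ζ ((2 * Real.pi) • w)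
  have h2 : (1 + ‖(2 * Real.pi) • w‖) ^ p * ‖(2 * Real.pi) • w‖
      ≤ (1 + ‖(2 * Real.pi) • w‖) ^ (k + 1) := by
    rw [pow_succ]
    have h3 : (1 : ℝ) ≤ 1 + ‖(2 * Real.pi) • w‖ := by linarith [norm_nonneg ((2 * Real.pi) • w)]
    have h4 := Real.rpow_le_rpow_of_exponent_le h3 hk
    rw [Real.rpow_natCast] at h4
    gcongr
    linarith
  calc _ ≤ C * (1 + ‖ζ‖) ^ (-p) * (1 + ‖(2 * Real.pi) • w‖) ^ (k + 1) * ‖𝓕 S w‖ := by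
        gcongr
        exact h1.trans (by gcongr)
    _ = _ := by ring

end

/-! ### Second moments of the Fourier transform of the random field -/

section

open scoped FourierTransform SchwartzMap

variable {n : ℕ}

/-- One derivative in `ξ` gains one order, whence the exponent `m + 1`; only the estimates with no
derivative in `x` are used. -/
theorem IsClassicalSymbol.exists_isTameSymbol {m : ℝ} (hm : 0 ≤ m) {c : Rn n → Rn n → ℂ}
    {a : ℕ → Rn n → Rn n → ℂ} (h : IsClassicalSymbol (-m) c a) :
    ∃ C, IsTameSymbol (m + 1) c C := by
  obtain ⟨hs, hb⟩ := h.isSymbol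
  obtain ⟨C₀, hC₀⟩ := hb 0 0
  obtain ⟨C₁, hC₁⟩ := hb 0 1
  have hx : ∀ x, ContDiff ℝ ∞ (c x) := fun x =>
    hs.comp (g := fun p : Rn n × Rn n => c p.1 p.2) (f := fun ξ => (x, ξ)) (by fun_prop)
  refine ⟨max |C₀| |C₁|, hs.continuous, fun x => (hx x).differentiable (by simp), fun x ξ => ?_,
    fun x ξ => ?_⟩
  · have h1 := hC₀ x ξ
    rw [norm_iteratedFDeriv_zero, norm_iteratedFDeriv_zero] at h1
    have h2 : (1 + ‖ξ‖) ^ (-m - ((0 : ℕ) : ℝ)) ≤ 1 :=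
      Real.rpow_le_one_of_one_le_of_nonpos (by linarith [norm_nonneg ξ]) (by simpa using hm)
    calc _ ≤ _ := h1
      _ ≤ |C₀| * (1 + ‖ξ‖) ^ (-m - ((0 : ℕ) : ℝ)) := by gcongr; exact le_abs_self _
      _ ≤ |C₀| * 1 := by gcongr
      _ ≤ _ := by rw [mul_one]; exact le_max_left _ _
  · have h1 := hC₁ x ξ
    rw [norm_iteratedFDeriv_zero, norm_iteratedFDeriv_one] at h1
    rw [show -(m + 1) = -m - ((1 : ℕ) : ℝ) by push_cast; ring]
    refine h1.trans ?_
    gcongr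
    exact (le_abs_self _).trans (le_max_right _ _)

theorem IsClassicalSymbol.exists_norm_sub_principal_le {m : ℝ} {c : Rn n → Rn n → ℂ}
    {a : ℕ → Rn n → Rn n → ℂ} (h : IsClassicalSymbol (-m) c a) :
    ∃ C : ℝ, ∀ x ξ : Rn n, 1 ≤ ‖ξ‖ → ‖c x ξ - a 0 x ξ‖ ≤ C * (1 + ‖ξ‖) ^ (-(m + 1)) := by
  obtain ⟨r, ⟨-, hr⟩, he⟩ := h.expansion 1
  obtain ⟨C, hC⟩ := hr 0 0
  refine ⟨C, fun x ξ hξ => ?_⟩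
  have h1 := hC x ξ
  rw [norm_iteratedFDeriv_zero, norm_iteratedFDeriv_zero] at h1
  rw [he x ξ hξ]
  simp only [Finset.range_one, Finset.sum_singleton, add_sub_cancel_left]
  convert h1 using 3
  push_cast
  ring

/-- A test function as a complex Schwartz function. -/
def toSchwartz (φ : RealTest n) : 𝓢(Rn n, ℂ) :=
  HasCompactSupport.toSchwartzMap (f := fun x => (φ x : ℂ))
    (φ.hasCompactSupport.comp_left (g := fun t : ℝ => (t : ℂ)) Complex.ofReal_zero)
    (Complex.ofRealCLM.contDiff.comp φ.contDiff)

theorem toSchwartz_apply (φ : RealTest n) (x : Rn n) : toSchwartz φ x = (φ x : ℂ) := rfl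

/-- The cutoff as a test function. -/
def cutoffTest (n N : ℕ) : RealTest n := cutoffMul N (fun _ => 1) contDiff_const

theorem cutoffTest_apply (N : ℕ) (x : Rn n) : cutoffTest n N x = cutoff n N x := by
  change cutoff n N x * 1 = _
  rw [mul_one]

theorem toSchwartz_cosTest_add_sinTest (N : ℕ) (ζ y : Rn n) :
    toSchwartz (cosTest N ζ) y + Complex.I * toSchwartz (sinTest N ζ) y
      = toSchwartz (cutoffTest n N) y * planeWave ζ y := by
  rw [toSchwartz_apply, toSchwartz_apply, toSchwartz_apply, cosTest_apply, sinTest_apply,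
    cutoffTest_apply]
  conv_rhs => rw [← Complex.re_add_im (planeWave ζ y)]
  push_cast
  ring

/-- The Fourier–Laplace transform `∫ μ(x) exp(i ζ · x) dx`. -/
def waveTransform (μ : Rn n → ℝ) (ζ : Rn n) : ℂ := ∫ x, (μ x : ℂ) * planeWave ζ x

/-- Two replacements, each costing one order: the operator by its symbol at `ζ`, and the symbol by
its principal part. The pairing is bilinear without conjugation, so the phases add to `ζ + ζ'`. -/
theorem exists_norm_pairing_sub_le {m C : ℝ} (hm : 0 ≤ m) {c : Rn n → Rn n → ℂ}
    (h : IsTameSymbol (m + 1) c C) {μ : Rn n → ℝ} {A : ℝ}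
    (hμc : Continuous μ) (hμ : ∀ x ξ : Rn n, 1 ≤ ‖ξ‖ →
      ‖c x ξ - ((μ x * ‖ξ‖ ^ (-m) : ℝ) : ℂ)‖ ≤ A * (1 + ‖ξ‖) ^ (-(m + 1)))
    {N : ℕ} (hμN : ∀ x, μ x * cutoff n N x = μ x) :
    ∃ B : ℝ, ∀ ζ ζ' : Rn n, 1 ≤ ‖ζ‖ →
      ‖(∫ x, symbolOp c (fun y => toSchwartz (cutoffTest n N) y * planeWave ζ y) x
          * (toSchwartz (cutoffTest n N) x * planeWave ζ' x))
        - ((‖ζ‖ ^ (-m) : ℝ) : ℂ) * waveTransform μ (ζ + ζ')‖ ≤ B * (1 + ‖ζ‖) ^ (-(m + 1)) := by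
  set S := toSchwartz (cutoffTest n N) with hS
  obtain ⟨A', hA'⟩ := h.exists_norm_symbolOp_mul_planeWave_sub_le (by linarith) S
  have hS1 : ∀ x, ‖S x‖ ≤ 1 := fun x => by
    rw [hS, toSchwartz_apply, cutoffTest_apply, Complex.norm_real,
      Real.norm_of_nonneg (cutoff n N).nonneg]
    exact (cutoff n N).le_one
  refine ⟨(A' + A) * ∫ x, ‖S x‖, fun ζ ζ' hζ => ?_⟩
  have hpt : ∀ x, ‖symbolOp c (fun y => S y * planeWave ζ y) x
      - planeWave ζ x * ((μ x * ‖ζ‖ ^ (-m) : ℝ) : ℂ) * S x‖ ≤ (A' + A) * (1 + ‖ζ‖) ^ (-(m + 1)) := by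
    intro x
    calc _ = ‖(symbolOp c (fun y => S y * planeWave ζ y) x - planeWave ζ x * c x ζ * S x)
          + planeWave ζ x * (c x ζ - ((μ x * ‖ζ‖ ^ (-m) : ℝ) : ℂ)) * S x‖ := by congr 1; ring
      _ ≤ A' * (1 + ‖ζ‖) ^ (-(m + 1)) + A * (1 + ‖ζ‖) ^ (-(m + 1)) := by
          refine (norm_add_le _ _).trans (add_le_add (hA' ζ x) ?_)
          rw [norm_mul, norm_mul, norm_planeWave, one_mul]
          calc _ ≤ ‖c x ζ - ((μ x * ‖ζ‖ ^ (-m) : ℝ) : ℂ)‖ * 1 := by gcongr; exact hS1 x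
            _ ≤ _ := by rw [mul_one]; exact hμ x ζ hζ
      _ = _ := by ring
  have hmain : ((‖ζ‖ ^ (-m) : ℝ) : ℂ) * waveTransform μ (ζ + ζ')
      = ∫ x, planeWave ζ x * ((μ x * ‖ζ‖ ^ (-m) : ℝ) : ℂ) * S x * (S x * planeWave ζ' x) := by
    rw [waveTransform, ← integral_const_mul]
    congr 1
    ext x
    rw [planeWave_add, hS, toSchwartz_apply, cutoffTest_apply]
    -- Both cutoff factors of the pairing are inserted, which is harmless because `μ = μχ = μχχ`.
    nth_rewrite 1 [← hμN x, ← hμN x]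
    push_cast
    ring
  have e : (fun y => S y * planeWave ζ y)
      = fun y => toSchwartz (cosTest N ζ) y + Complex.I * toSchwartz (sinTest N ζ) y := by
    ext y
    rw [toSchwartz_cosTest_add_sinTest]
  have e' : (fun y => S y * planeWave ζ' y)
      = ((toSchwartz (cosTest N ζ') + Complex.I • toSchwartz (sinTest N ζ') : 𝓢(Rn n, ℂ)) :
        Rn n → ℂ) := by
    ext y
    rw [← toSchwartz_cosTest_add_sinTest]
    simp
  have i1 : Integrable fun x => symbolOp c (fun y => S y * planeWave ζ y) x
      * (S x * planeWave ζ' x) := by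
    have e2 : (fun y => S y * planeWave ζ y)
        = ((toSchwartz (cosTest N ζ) + Complex.I • toSchwartz (sinTest N ζ) : 𝓢(Rn n, ℂ)) :
          Rn n → ℂ) := by
      rw [e]; ext y; simp
    have := h.integrable_symbolOp_mul
      (toSchwartz (cosTest N ζ) + Complex.I • toSchwartz (sinTest N ζ))
      (toSchwartz (cosTest N ζ') + Complex.I • toSchwartz (sinTest N ζ'))
    rw [← e2, ← e'] at this
    exact this
  have i2 : Integrable fun x => planeWave ζ x * ((μ x * ‖ζ‖ ^ (-m) : ℝ) : ℂ) * S x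
      * (S x * planeWave ζ' x) := by
    refine Continuous.integrable_of_hasCompactSupport ?_ ?_
    · have h1 := continuous_planeWave ζ
      have h2 := continuous_planeWave ζ'
      have h3 := S.continuous
      fun_prop
    · refine HasCompactSupport.mul_left (HasCompactSupport.mul_right ?_)
      exact (cutoffTest n N).hasCompactSupport.comp_left (g := fun t : ℝ => (t : ℂ))
        Complex.ofReal_zero
  rw [hmain, ← integral_sub i1 i2, mul_right_comm, ← integral_const_mul]
  refine norm_integral_le_of_norm_le (S.integrable.norm.const_mul _) (ae_of_all _ fun x => ?_)
  rw [← sub_mul, norm_mul, norm_mul (S x), norm_planeWave, mul_one]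
  exact mul_le_mul_of_nonneg_right (hpt x) (norm_nonneg _)

end

/-! ### Exact second moments: covariance plus product of means. -/

section

open scoped FourierTransform SchwartzMap

variable {Ω : Type u} [MeasurableSpace Ω] {n : ℕ} {P : Measure Ω} {q : Ω → RealTest n →ₗ[ℝ] ℝ}

theorem IsGaussianGeneralizedRandomFunction.memLp_two
    (hq : IsGaussianGeneralizedRandomFunction P q) (φ : RealTest n) :
    MemLp (fun w => q w φ) 2 P :=
  (hq.gaussian.hasGaussianLaw_eval φ).memLp_two

theorem IsGaussianGeneralizedRandomFunction.integral_mul_eq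
    (hq : IsGaussianGeneralizedRandomFunction P q) {g : Rn n → ℝ} {c : Rn n → Rn n → ℂ}
    (hg : ∀ φ : RealTest n, ∫ w, q w φ ∂P = ∫ x, g x * φ x)
    (hc : ∀ φ ψ : RealTest n, ((cov[fun w => q w φ, fun w => q w ψ; P] : ℝ) : ℂ) =
        ∫ x, pseudoOp c φ x * ((ψ x : ℝ) : ℂ)) (φ ψ : RealTest n) :
    ∫ w, (q w φ : ℂ) * (q w ψ : ℂ) ∂P = (∫ x, symbolOp c (toSchwartz φ) x * toSchwartz ψ x)
      + (∫ x, (g x : ℂ) * toSchwartz φ x) * ∫ x, (g x : ℂ) * toSchwartz ψ x := by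
  have hP := hq.gaussian.isProbabilityMeasure
  have h1 := covariance_eq_sub (hq.memLp_two φ) (hq.memLp_two ψ)
  have h2 := hc φ ψ
  rw [h1, hg, hg] at h2
  simp_rw [pseudoOp_eq_symbolOp] at h2
  have e : ∀ φ : RealTest n, ∫ x, (g x : ℂ) * toSchwartz φ x = ((∫ x, g x * φ x : ℝ) : ℂ) := by
    intro φ
    rw [← integral_complex_ofReal]
    congr 1; ext x
    rw [toSchwartz_apply]
    push_cast; rfl
  have e3 : ∫ w, (q w φ : ℂ) * (q w ψ : ℂ) ∂P = ((∫ w, q w φ * q w ψ ∂P : ℝ) : ℂ) := by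
    rw [← integral_complex_ofReal]
    congr 1; ext x
    push_cast; rfl
  rw [e, e, e3]
  simp only [Pi.mul_apply] at h2
  push_cast at h2 ⊢
  exact eq_add_of_sub_eq h2

/-- The Fourier–Laplace transform of the (cut off) random field. -/
def fieldTransform (N : ℕ) (v : RealTest n →ₗ[ℝ] ℝ) (ζ : Rn n) : ℂ :=
  (v (cosTest N ζ) : ℂ) + Complex.I * (v (sinTest N ζ) : ℂ)

theorem fieldTransform_neg (N : ℕ) (v : RealTest n →ₗ[ℝ] ℝ) (ζ : Rn n) :
    fieldTransform N v (-ζ) = (starRingEnd ℂ) (fieldTransform N v ζ) := by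
  simp [fieldTransform, cosTest_neg, sinTest_neg]

theorem integral_add_I_mul_sub {α : Type*} [MeasurableSpace α] {ν : Measure α}
    {f₁ f₂ f₃ f₄ : α → ℂ} (h1 : Integrable f₁ ν) (h2 : Integrable f₂ ν) (h3 : Integrable f₃ ν)
    (h4 : Integrable f₄ ν) :
    ∫ x, (f₁ x + Complex.I * f₂ x + Complex.I * f₃ x - f₄ x) ∂ν
      = (∫ x, f₁ x ∂ν) + Complex.I * (∫ x, f₂ x ∂ν) + Complex.I * (∫ x, f₃ x ∂ν)
        - ∫ x, f₄ x ∂ν := by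
  have h12 : Integrable (fun x => f₁ x + Complex.I * f₂ x) ν := h1.add (h2.const_mul _)
  have h123 : Integrable (fun x => f₁ x + Complex.I * f₂ x + Complex.I * f₃ x) ν :=
    h12.add (h3.const_mul _)
  rw [integral_sub h123 h4, integral_add h12 (h3.const_mul _), integral_add h1 (h2.const_mul _),
    integral_const_mul, integral_const_mul]

/-- The covariance hypothesis concerns real test functions only; complex bilinearity extends it to
cosine plus `i` times sine. -/
theorem IsGaussianGeneralizedRandomFunction.integral_fieldTransform_mul
    (hq : IsGaussianGeneralizedRandomFunction P q) {g : Rn n → ℝ} {c : Rn n → Rn n → ℂ}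
    {p C : ℝ} (h : IsTameSymbol p c C) (hgc : Continuous g)
    (hg : ∀ φ : RealTest n, ∫ w, q w φ ∂P = ∫ x, g x * φ x)
    (hc : ∀ φ ψ : RealTest n, ((cov[fun w => q w φ, fun w => q w ψ; P] : ℝ) : ℂ) =
        ∫ x, pseudoOp c φ x * ((ψ x : ℝ) : ℂ)) (N : ℕ) (ζ ζ' : Rn n) :
    ∫ w, fieldTransform N (q w) ζ * fieldTransform N (q w) ζ' ∂P
      = (∫ x, symbolOp c (fun y => toSchwartz (cutoffTest n N) y * planeWave ζ y) x
          * (toSchwartz (cutoffTest n N) x * planeWave ζ' x))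
        + (∫ x, (g x : ℂ) * (toSchwartz (cutoffTest n N) x * planeWave ζ x))
          * ∫ x, (g x : ℂ) * (toSchwartz (cutoffTest n N) x * planeWave ζ' x) := by
  have hM := hq.integral_mul_eq hg hc
  have iq : ∀ φ ψ : RealTest n, Integrable (fun w => (q w φ : ℂ) * (q w ψ : ℂ)) P := by
    intro φ ψ
    have := ((hq.memLp_two φ).integrable_mul (hq.memLp_two ψ)).ofReal (𝕜 := ℂ)
    refine this.congr (ae_of_all _ fun w => ?_)
    simp
  have iS := h.integrable_symbolOp_mul
  have ig : ∀ φ : RealTest n, Integrable fun x => (g x : ℂ) * toSchwartz φ x := by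
    intro φ
    refine Continuous.integrable_of_hasCompactSupport ?_ ?_
    · exact (Complex.continuous_ofReal.comp hgc).mul (toSchwartz φ).continuous
    · exact HasCompactSupport.mul_left
        (φ.hasCompactSupport.comp_left (g := fun t : ℝ => (t : ℂ)) Complex.ofReal_zero)
  have eg : ∀ ζ : Rn n, ∫ x, (g x : ℂ) * (toSchwartz (cutoffTest n N) x * planeWave ζ x)
      = (∫ x, (g x : ℂ) * toSchwartz (cosTest N ζ) x)
        + Complex.I * ∫ x, (g x : ℂ) * toSchwartz (sinTest N ζ) x := by
    intro ζ
    rw [← integral_const_mul, ← integral_add (ig _) ((ig _).const_mul _)]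
    congr 1; ext x
    rw [← toSchwartz_cosTest_add_sinTest]
    ring
  have eL : ∀ w, fieldTransform N (q w) ζ * fieldTransform N (q w) ζ'
      = (q w (cosTest N ζ) : ℂ) * (q w (cosTest N ζ') : ℂ)
        + Complex.I * ((q w (cosTest N ζ) : ℂ) * (q w (sinTest N ζ') : ℂ))
        + Complex.I * ((q w (sinTest N ζ) : ℂ) * (q w (cosTest N ζ') : ℂ))
        - (q w (sinTest N ζ) : ℂ) * (q w (sinTest N ζ') : ℂ) := by
    intro w
    simp only [fieldTransform]
    ring_nf
    rw [Complex.I_sq]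
    ring
  have eR : ∀ x, symbolOp c (fun y => toSchwartz (cutoffTest n N) y * planeWave ζ y) x
          * (toSchwartz (cutoffTest n N) x * planeWave ζ' x)
      = symbolOp c (toSchwartz (cosTest N ζ)) x * toSchwartz (cosTest N ζ') x
        + Complex.I * (symbolOp c (toSchwartz (cosTest N ζ)) x * toSchwartz (sinTest N ζ') x)
        + Complex.I * (symbolOp c (toSchwartz (sinTest N ζ)) x * toSchwartz (cosTest N ζ') x)
        - symbolOp c (toSchwartz (sinTest N ζ)) x * toSchwartz (sinTest N ζ') x := by
    intro x
    simp_rw [← toSchwartz_cosTest_add_sinTest]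
    rw [h.symbolOp_add_smul]
    ring_nf
    rw [Complex.I_sq]
    ring
  simp_rw [eL, eR]
  rw [integral_add_I_mul_sub (iq _ _) (iq _ _) (iq _ _) (iq _ _),
    integral_add_I_mul_sub (iS _ _) (iS _ _) (iS _ _) (iS _ _), eg, eg, hM, hM, hM, hM]
  ring_nf
  rw [Complex.I_sq]
  ring

end

/-! ### Decay of correlations -/

section

open scoped FourierTransform SchwartzMap

variable {Ω : Type u} [MeasurableSpace Ω] {n : ℕ} {P : Measure Ω} {q : Ω → RealTest n →ₗ[ℝ] ℝ}

theorem mul_cutoff_eq_self {μ : Rn n → ℝ} {N : ℕ} (hμ : tsupport μ ⊆ Metric.closedBall 0 N)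
    (x : Rn n) : μ x * cutoff n N x = μ x := by
  by_cases hx : x ∈ tsupport μ
  · have := hμ hx
    rw [Metric.mem_closedBall, dist_zero_right] at this
    rw [cutoff_eq_one (by linarith), mul_one]
  · rw [image_eq_zero_of_notMem_tsupport hx, zero_mul]

/-- The second moments of the Fourier transform of a microlocally isotropic field, to leading
order. -/
theorem exists_norm_integral_fieldTransform_mul_sub_le {D : Set (Rn n)} {m : ℝ} (hm : 0 ≤ m)
    {μ : Rn n → ℝ} (hq : IsGaussianGeneralizedRandomFunction P q)
    (hiso : IsMicrolocallyIsotropic P q D m μ) {N : ℕ} (hD : D ⊆ Metric.closedBall 0 N) :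
    ∃ B : ℝ, 0 ≤ B ∧ ∀ ζ ζ' : Rn n, 1 ≤ ‖ζ‖ →
      ‖(∫ w, fieldTransform N (q w) ζ * fieldTransform N (q w) ζ' ∂P)
        - ((‖ζ‖ ^ (-m) : ℝ) : ℂ) * waveTransform μ (ζ + ζ')‖ ≤ B * (1 + ‖ζ‖) ^ (-(m + 1)) := by
  obtain ⟨g, hgs, hg⟩ := hiso.mean_smooth
  obtain ⟨c, a, hca, ha, hc⟩ := hiso.covariance
  obtain ⟨C, hC⟩ := hca.exists_isTameSymbol hm
  obtain ⟨A, hA⟩ := hca.exists_norm_sub_principal_le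
  obtain ⟨B, hB⟩ := exists_norm_pairing_sub_le hm hC hiso.strength_smooth.continuous
    (A := A) (fun x ξ hξ => by
      rw [← ha x ξ (norm_pos_iff.1 (by linarith))]; exact hA x ξ hξ)
    (mul_cutoff_eq_self (hiso.strength_support.trans hD))
  -- The transform of the cut-off smooth mean decays faster than any power; order `k ≥ m + 1` in `ζ`
  -- puts its contribution into the error.
  obtain ⟨k, hk⟩ := exists_nat_ge (m + 1)
  obtain ⟨G, hG0, hG⟩ := (toSchwartz (smoothMul g hgs
    (cutoffTest n N))).exists_norm_integral_mul_planeWave_le k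
  have hG' : ∀ ζ, ‖∫ x, (g x : ℂ) * (toSchwartz (cutoffTest n N) x * planeWave ζ x)‖
      ≤ G * ((1 + ‖ζ‖) ^ k)⁻¹ := by
    intro ζ
    convert hG ζ using 4
    rw [toSchwartz_apply, toSchwartz_apply, smoothMul_apply]
    push_cast
    ring
  refine ⟨|B| + G * G, by positivity, fun ζ ζ' hζ => ?_⟩
  rw [hq.integral_fieldTransform_mul hC hgs.continuous hg hc, add_sub_right_comm, add_mul]
  refine (norm_add_le _ _).trans (add_le_add ((hB ζ ζ' hζ).trans ?_) ?_)
  · gcongr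
    exact le_abs_self B
  · rw [norm_mul]
    have h1 : ((1 + ‖ζ'‖) ^ k)⁻¹ ≤ 1 :=
      inv_le_one_of_one_le₀ (one_le_pow₀ (by linarith [norm_nonneg ζ']))
    have h2 : ((1 + ‖ζ‖) ^ k)⁻¹ ≤ (1 + ‖ζ‖) ^ (-(m + 1)) := by
      rw [← Real.rpow_natCast, ← Real.rpow_neg (by positivity)]
      exact Real.rpow_le_rpow_of_exponent_le (by linarith [norm_nonneg ζ]) (by linarith)
    calc _ ≤ (G * ((1 + ‖ζ‖) ^ k)⁻¹) * (G * ((1 + ‖ζ'‖) ^ k)⁻¹) := by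
          gcongr
          · exact hG' ζ
          · exact hG' ζ'
      _ ≤ (G * (1 + ‖ζ‖) ^ (-(m + 1))) * (G * 1) := by gcongr
      _ = _ := by ring

theorem exists_norm_waveTransform_le {μ : Rn n → ℝ} (hμ : ContDiff ℝ ∞ μ)
    (hμc : HasCompactSupport μ) : ∃ C : ℝ, 0 ≤ C ∧ ∀ ζ, ‖waveTransform μ ζ‖ ≤ C * (1 + ‖ζ‖)⁻¹ := by
  obtain ⟨C, hC0, hC⟩ := (toSchwartz (⟨μ, hμ, hμc, fun _ _ => trivial⟩ :
    RealTest n)).exists_norm_integral_mul_planeWave_le 1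
  exact ⟨C, hC0, fun ζ => by simpa using! hC ζ⟩

/-- Decay of the transform of `μ` together with `‖ζ + ζ'‖ ≥ ‖ζ‖ - ‖ζ'‖` separates the frequencies.
The halves are chosen so that `ζ = 2tθ`, `ζ' = ±2sθ` give `t^(-m) (1 + (t - s))⁻¹`. -/
theorem exists_norm_integral_fieldTransform_mul_le {D : Set (Rn n)} {m : ℝ} (hm : 0 ≤ m)
    {μ : Rn n → ℝ} (hq : IsGaussianGeneralizedRandomFunction P q)
    (hiso : IsMicrolocallyIsotropic P q D m μ) {N : ℕ} (hD : D ⊆ Metric.closedBall 0 N) :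
    ∃ C : ℝ, 0 ≤ C ∧ ∀ ζ ζ' : Rn n, 2 ≤ ‖ζ‖ → ‖ζ'‖ ≤ ‖ζ‖ →
      ‖∫ w, fieldTransform N (q w) ζ * fieldTransform N (q w) ζ' ∂P‖
        ≤ C * ((‖ζ‖ / 2) ^ (-m) * (1 + (‖ζ‖ - ‖ζ'‖) / 2)⁻¹) := by
  obtain ⟨B, hB0, hB⟩ := exists_norm_integral_fieldTransform_mul_sub_le hm hq hiso hD
  obtain ⟨A, hA0, hA⟩ := exists_norm_waveTransform_le hiso.strength_smooth hiso.strength_compact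
  refine ⟨A + B, by positivity, fun ζ ζ' hζ hζζ' => ?_⟩
  have h1 := hB ζ ζ' (by linarith)
  have h2 := hA (ζ + ζ')
  have hpos : 0 < ‖ζ‖ := by linarith
  have h3 : ‖ζ‖ ^ (-m) ≤ (‖ζ‖ / 2) ^ (-m) :=
    Real.rpow_le_rpow_of_nonpos (by positivity) (by linarith) (by linarith)
  have h4 : ‖ζ‖ - ‖ζ'‖ ≤ ‖ζ + ζ'‖ := by
    have := _root_.norm_sub_le (ζ + ζ') ζ'
    rw [add_sub_cancel_right] at this
    linarith
  have h5 : (1 + ‖ζ + ζ'‖)⁻¹ ≤ (1 + (‖ζ‖ - ‖ζ'‖) / 2)⁻¹ :=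
    inv_anti₀ (by linarith) (by linarith)
  have h6 : (1 + ‖ζ‖) ^ (-(m + 1)) ≤ (‖ζ‖ / 2) ^ (-m) * (1 + (‖ζ‖ - ‖ζ'‖) / 2)⁻¹ := by
    rw [neg_add, Real.rpow_add (by positivity), Real.rpow_neg_one]
    refine mul_le_mul ?_ ?_ (by positivity) (by positivity)
    · exact Real.rpow_le_rpow_of_nonpos (by positivity) (by linarith) (by linarith)
    · exact inv_anti₀ (by linarith) (by linarith [norm_nonneg ζ'])
  have h7 : ‖((‖ζ‖ ^ (-m) : ℝ) : ℂ) * waveTransform μ (ζ + ζ')‖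
      ≤ A * ((‖ζ‖ / 2) ^ (-m) * (1 + (‖ζ‖ - ‖ζ'‖) / 2)⁻¹) := by
    rw [norm_mul, Complex.norm_real, Real.norm_of_nonneg (by positivity)]
    calc _ ≤ (‖ζ‖ / 2) ^ (-m) * (A * (1 + (‖ζ‖ - ‖ζ'‖) / 2)⁻¹) := by
          gcongr
          exact h2.trans (by gcongr)
      _ = _ := by ring
  have h8 := norm_le_insert' (∫ w, fieldTransform N (q w) ζ * fieldTransform N (q w) ζ' ∂P)
    (((‖ζ‖ ^ (-m) : ℝ) : ℂ) * waveTransform μ (ζ + ζ'))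
  calc _ ≤ _ := h8
    _ ≤ A * ((‖ζ‖ / 2) ^ (-m) * (1 + (‖ζ‖ - ‖ζ'‖) / 2)⁻¹)
        + B * ((‖ζ‖ / 2) ^ (-m) * (1 + (‖ζ‖ - ‖ζ'‖) / 2)⁻¹) :=
      add_le_add h7 (h1.trans (by gcongr))
    _ = _ := by ring

/-- The test functions `χ_N cos(ζ · y)` and `χ_N sin(ζ · y)`. -/
def waveTest (N : ℕ) (b : Bool) (ζ : Rn n) : RealTest n := if b then sinTest N ζ else cosTest N ζ

theorem IsGaussianGeneralizedRandomFunction.integrable_mul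
    (hq : IsGaussianGeneralizedRandomFunction P q) (φ ψ : RealTest n) :
    Integrable (fun w => q w φ * q w ψ) P :=
  (hq.memLp_two φ).integrable_mul (hq.memLp_two ψ)

theorem IsGaussianGeneralizedRandomFunction.integrable_fieldTransform_mul
    (hq : IsGaussianGeneralizedRandomFunction P q) (N : ℕ) (ζ ζ' : Rn n) :
    Integrable (fun w => fieldTransform N (q w) ζ * fieldTransform N (q w) ζ') P := by
  have h : ∀ ζ, MemLp (fun w => fieldTransform N (q w) ζ) 2 P := by
    intro ζ
    have h1 : MemLp (fun w => (q w (cosTest N ζ) : ℂ)) 2 P := (hq.memLp_two (cosTest N ζ)).ofReal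
    have h2 : MemLp (fun w => (q w (sinTest N ζ) : ℂ)) 2 P := (hq.memLp_two (sinTest N ζ)).ofReal
    exact h1.add (h2.const_mul Complex.I)
  exact (h ζ).integrable_mul (h ζ')

/-- Each of the four real cosine–sine moments is, up to sign, half a sum or difference of real or
imaginary parts of the moments at `ζ'` and `-ζ'`, so the same bound `R` survives. -/
theorem IsGaussianGeneralizedRandomFunction.abs_integral_waveTest_mul_le
    (hq : IsGaussianGeneralizedRandomFunction P q) (N : ℕ) (b b' : Bool) (ζ ζ' : Rn n) {R : ℝ}
    (h1 : ‖∫ w, fieldTransform N (q w) ζ * fieldTransform N (q w) ζ' ∂P‖ ≤ R)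
    (h2 : ‖∫ w, fieldTransform N (q w) ζ * fieldTransform N (q w) (-ζ') ∂P‖ ≤ R) :
    |∫ w, q w (waveTest N b ζ) * q w (waveTest N b' ζ') ∂P| ≤ R := by
  set U := ∫ w, fieldTransform N (q w) ζ * fieldTransform N (q w) ζ' ∂P with hU
  set V := ∫ w, fieldTransform N (q w) ζ * fieldTransform N (q w) (-ζ') ∂P with hV
  have iU := hq.integrable_fieldTransform_mul N ζ ζ'
  have iV := hq.integrable_fieldTransform_mul N ζ (-ζ')
  have i := hq.integrable_mul
  have re : ∀ {f : Ω → ℂ}, Integrable f P → (∫ w, f w ∂P).re = ∫ w, (f w).re ∂P :=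
    fun hf => (integral_re hf).symm
  have im : ∀ {f : Ω → ℂ}, Integrable f P → (∫ w, f w ∂P).im = ∫ w, (f w).im ∂P :=
    fun hf => (integral_im hf).symm
  have eUr := re iU
  have eUi := im iU
  have eVr := re iV
  have eVi := im iV
  rw [← hU] at eUr eUi
  rw [← hV] at eVr eVi
  simp only [fieldTransform, cosTest_neg, sinTest_neg, map_neg, Complex.mul_re, Complex.add_re,
    Complex.ofReal_re, Complex.I_re, Complex.ofReal_im, Complex.I_im, Complex.mul_im,
    Complex.add_im, Complex.ofReal_neg, Complex.neg_re, Complex.neg_im, zero_mul, one_mul, mul_zero,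
    sub_zero, add_zero, zero_add, neg_zero, mul_neg, sub_neg_eq_add] at eUr eUi eVr eVi
  rw [integral_sub (i _ _) (i _ _)] at eUr
  rw [integral_add (i _ _) (i _ _)] at eUi eVr
  have ineg : Integrable (fun w => -(q w (cosTest N ζ) * q w (sinTest N ζ'))) P := (i _ _).neg
  rw [integral_add ineg (i _ _), integral_neg] at eVi
  have a1 := abs_le.1 ((Complex.abs_re_le_norm U).trans h1)
  have a2 := abs_le.1 ((Complex.abs_im_le_norm U).trans h1)
  have a3 := abs_le.1 ((Complex.abs_re_le_norm V).trans h2)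
  have a4 := abs_le.1 ((Complex.abs_im_le_norm V).trans h2)
  rw [abs_le]
  cases b <;> cases b' <;> simp only [waveTest, if_true, if_false, Bool.false_eq_true] <;>
    constructor <;> linarith [a1.1, a1.2, a2.1, a2.2, a3.1, a3.2, a4.1, a4.2]

theorem exists_abs_integral_waveTest_mul_le {D : Set (Rn n)} {m : ℝ} (hm : 0 ≤ m)
    {μ : Rn n → ℝ} (hq : IsGaussianGeneralizedRandomFunction P q)
    (hiso : IsMicrolocallyIsotropic P q D m μ) {N : ℕ} (hD : D ⊆ Metric.closedBall 0 N) :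
    ∃ C : ℝ, 0 ≤ C ∧ ∀ (θ : Rn n), ‖θ‖ = 1 → ∀ (b b' : Bool) (t s : ℝ), 1 ≤ t → 1 ≤ s →
      |∫ w, q w (waveTest N b ((2 * t) • θ)) * q w (waveTest N b' ((2 * s) • θ)) ∂P|
        ≤ C * ((max t s) ^ (-m) * (1 + |t - s|)⁻¹) := by
  obtain ⟨C, hC0, hC⟩ := exists_norm_integral_fieldTransform_mul_le hm hq hiso hD
  refine ⟨C, hC0, fun θ hθ => ?_⟩
  have hnorm : ∀ t : ℝ, 1 ≤ t → ‖(2 * t) • θ‖ = 2 * t := fun t ht => by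
    rw [norm_smul, hθ, mul_one, Real.norm_of_nonneg (by linarith)]
  have key : ∀ (b b' : Bool) (t s : ℝ), 1 ≤ t → 1 ≤ s → s ≤ t →
      |∫ w, q w (waveTest N b ((2 * t) • θ)) * q w (waveTest N b' ((2 * s) • θ)) ∂P|
        ≤ C * ((max t s) ^ (-m) * (1 + |t - s|)⁻¹) := by
    intro b b' t s ht hs hst
    refine hq.abs_integral_waveTest_mul_le N b b' _ _ ?_ ?_
    · have := hC ((2 * t) • θ) ((2 * s) • θ) (by rw [hnorm t ht]; linarith)
        (by rw [hnorm t ht, hnorm s hs]; linarith)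
      rw [hnorm t ht, hnorm s hs, mul_div_cancel_left₀ _ two_ne_zero, ← mul_sub,
        mul_div_cancel_left₀ _ two_ne_zero] at this
      rwa [max_eq_left hst, abs_of_nonneg (by linarith)]
    · have := hC ((2 * t) • θ) (-((2 * s) • θ)) (by rw [hnorm t ht]; linarith)
        (by rw [norm_neg, hnorm t ht, hnorm s hs]; linarith)
      rw [norm_neg, hnorm t ht, hnorm s hs, mul_div_cancel_left₀ _ two_ne_zero, ← mul_sub,
        mul_div_cancel_left₀ _ two_ne_zero] at this
      rwa [max_eq_left hst, abs_of_nonneg (by linarith)]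
  intro b b' t s ht hs
  rcases le_total s t with h | h
  · exact key b b' t s ht hs h
  · simp_rw [mul_comm (q _ (waveTest N b _))]
    rw [max_comm, abs_sub_comm]
    exact key b' b s t hs ht h

end

/-! ### The single-scattering data of a microlocally isotropic field -/

section

variable {Ω : Type u} [MeasurableSpace Ω] {n : ℕ} {P : Measure Ω} {q : Ω → RealTest n →ₗ[ℝ] ℝ}

/-- The test function `t^(m/2) χ_N cos(2 (t + τ) θ · y)`, or its sine counterpart. -/
def scaledWaveTest (m : ℝ) (N : ℕ) (θ : Rn n) (b : Bool) (τ t : ℝ) : RealTest n :=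
  (t ^ (m / 2)) • waveTest N b ((2 * (t + τ)) • θ)

/-- The weights `t^(m/2) s^(m/2)` are at most the `m`-th power of the larger frequency and cancel
the decay of the spectrum; the shifts cost the factor `1 + |τ - τ'|`. -/
theorem exists_abs_integral_scaledWaveTest_mul_le {D : Set (Rn n)} {m : ℝ} (hm : 0 ≤ m)
    {μ : Rn n → ℝ} (hq : IsGaussianGeneralizedRandomFunction P q)
    (hiso : IsMicrolocallyIsotropic P q D m μ) {N : ℕ} (hD : D ⊆ Metric.closedBall 0 N) :
    ∃ C : ℝ, 0 ≤ C ∧ ∀ (θ : Rn n), ‖θ‖ = 1 → ∀ (b b' : Bool) (τ τ' t s : ℝ), 0 ≤ τ → 0 ≤ τ' →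
      1 ≤ t → 1 ≤ s →
      |∫ w, q w (scaledWaveTest m N θ b τ t) * q w (scaledWaveTest m N θ b' τ' s) ∂P|
        ≤ C * (1 + |τ - τ'|) * (1 + |t - s|)⁻¹ := by
  obtain ⟨C, hC0, hC⟩ := exists_abs_integral_waveTest_mul_le hm hq hiso hD
  refine ⟨C, hC0, fun θ hθ b b' τ τ' t s hτ hτ' ht hs => ?_⟩
  have h1 := hC θ hθ b b' (t + τ) (s + τ') (by linarith) (by linarith)
  have e : ∫ w, q w (scaledWaveTest m N θ b τ t) * q w (scaledWaveTest m N θ b' τ' s) ∂P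
      = t ^ (m / 2) * s ^ (m / 2) * ∫ w, q w (waveTest N b ((2 * (t + τ)) • θ))
        * q w (waveTest N b' ((2 * (s + τ')) • θ)) ∂P := by
    rw [← integral_const_mul]
    congr 1
    ext w
    simp only [scaledWaveTest, map_smul, smul_eq_mul]
    ring
  set M := max (t + τ) (s + τ') with hMdef
  have hM1 : t ≤ M := le_trans (by linarith) (le_max_left _ _)
  have hM2 : s ≤ M := le_trans (by linarith) (le_max_right _ _)
  have hM0 : 0 < M := by linarith
  have h2 : t ^ (m / 2) * s ^ (m / 2) ≤ M ^ m := by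
    calc t ^ (m / 2) * s ^ (m / 2) ≤ M ^ (m / 2) * M ^ (m / 2) := by gcongr
      _ = M ^ m := by rw [← Real.rpow_add hM0, add_halves]
  have h3 : (1 + |t + τ - (s + τ')|)⁻¹ ≤ (1 + |τ - τ'|) * (1 + |t - s|)⁻¹ := by
    rw [← div_eq_mul_inv, le_div_iff₀ (by positivity), inv_mul_le_iff₀ (by positivity)]
    have h4 : |t - s| ≤ |t + τ - (s + τ')| + |τ - τ'| := by
      have := abs_sub (t + τ - (s + τ')) (τ - τ')
      rwa [show t + τ - (s + τ') - (τ - τ') = t - s by ring] at this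
    nlinarith [abs_nonneg (t + τ - (s + τ')), abs_nonneg (τ - τ')]
  rw [e, abs_mul, abs_of_nonneg (by positivity)]
  calc _ ≤ M ^ m * (C * (M ^ (-m) * (1 + |t + τ - (s + τ')|)⁻¹)) := by gcongr
    _ = C * (1 + |t + τ - (s + τ')|)⁻¹ := by
        rw [Real.rpow_neg hM0.le]
        field_simp
    _ ≤ C * ((1 + |τ - τ'|) * (1 + |t - s|)⁻¹) := by gcongr
    _ = _ := by ring

theorem IsGeneralizedRandomFunction.ae_continuous_waveTest
    (hq : IsGeneralizedRandomFunction P q) (N : ℕ) :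
    ∀ᵐ w ∂P, ∀ b, Continuous fun ζ : Rn n => q w (waveTest N b ζ) := by
  obtain ⟨C, M, -, -, -, hC⟩ := hq.bound (Metric.closedBall 0 (N + 2)) (isCompact_closedBall _ _)
  filter_upwards [hC] with w hw
  intro b
  cases b
  · exact continuous_apply_cutoffMul hw (F := fun ζ x => (planeWave ζ x).re)
      (Complex.reCLM.contDiff.comp contDiff_planeWave_uncurry)
      (fun ζ => Complex.reCLM.contDiff.comp (contDiff_planeWave ζ))
  · exact continuous_apply_cutoffMul hw (F := fun ζ x => (planeWave ζ x).im)
      (Complex.imCLM.contDiff.comp contDiff_planeWave_uncurry)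
      (fun ζ => Complex.imCLM.contDiff.comp (contDiff_planeWave ζ))

theorem continuous_apply_scaledWaveTest {v : RealTest n →ₗ[ℝ] ℝ} {N : ℕ} {b : Bool} {m : ℝ}
    (hm : 0 ≤ m) (hv : Continuous fun ζ : Rn n => v (waveTest N b ζ)) (θ : Rn n) (τ : ℝ) :
    Continuous fun t => v (scaledWaveTest m N θ b τ t) := by
  simp only [scaledWaveTest, map_smul, smul_eq_mul]
  refine (Real.continuous_rpow_const (by positivity)).mul ?_
  exact hv.comp (f := fun t : ℝ => (2 * (t + τ)) • θ) (by fun_prop)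

theorem ae_tendsto_average_scaledWaveTest {D : Set (Rn n)} {m : ℝ} (hm : 0 ≤ m)
    {μ : Rn n → ℝ} (hq : IsGaussianGeneralizedRandomFunction P q)
    (hiso : IsMicrolocallyIsotropic P q D m μ) {N : ℕ} (hD : D ⊆ Metric.closedBall 0 N)
    {θ : Rn n} (hθ : ‖θ‖ = 1) {τ : ℝ} (hτ : 0 ≤ τ) (b b' : Bool) :
    ∀ᵐ w ∂P, (∀ K, IntegrableOn (fun t => q w (scaledWaveTest m N θ b 0 t)
        * q w (scaledWaveTest m N θ b' τ t) - ∫ w', q w' (scaledWaveTest m N θ b 0 t)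
        * q w' (scaledWaveTest m N θ b' τ t) ∂P) (Ioc 1 K)) ∧
      Tendsto (fun K : ℝ => K⁻¹ * ∫ t in K..(2 * K), (q w (scaledWaveTest m N θ b 0 t)
        * q w (scaledWaveTest m N θ b' τ t) - ∫ w', q w' (scaledWaveTest m N θ b 0 t)
        * q w' (scaledWaveTest m N θ b' τ t) ∂P)) atTop (𝓝 0) := by
  obtain ⟨C, hC0, hC⟩ := exists_abs_integral_scaledWaveTest_mul_le hm hq hiso hD
  have hcont : ∀ (b : Bool) (τ : ℝ), ∀ᵐ w ∂P,
      Continuous fun t => q w (scaledWaveTest m N θ b τ t) := by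
    intro b τ
    filter_upwards [hq.ae_continuous_waveTest N] with w hw
    exact continuous_apply_scaledWaveTest hm (hw b) θ τ
  have hgauss : ∀ F : ℝ → RealTest n, IsGaussianProcess (fun t w => q w (F t)) P := fun F =>
    hq.gaussian.comp_right F
  have hle : ∀ (b b' : Bool) (τ₁ τ₂ : ℝ), 0 ≤ τ₁ → 0 ≤ τ₂ → |τ₁ - τ₂| ≤ τ → ∀ t s, 1 ≤ t → 1 ≤ s →
      |∫ w, q w (scaledWaveTest m N θ b τ₁ t) * q w (scaledWaveTest m N θ b' τ₂ s) ∂P|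
        ≤ C * (1 + τ) * (1 + |t - s|)⁻¹ := by
    intro b b' τ₁ τ₂ h1 h2 h3 t s ht hs
    refine (hC θ hθ b b' τ₁ τ₂ t s h1 h2 ht hs).trans ?_
    gcongr
  refine ae_tendsto_average_mul (C := C * (1 + τ)) (hgauss _) (hgauss _) ?_ ?_
    (fun t => hq.measurable _) (fun t => hq.measurable _) (hcont b 0) (hcont b' τ)
    (hle b b 0 0 le_rfl le_rfl (by simpa using hτ))
    (hle b b' 0 τ le_rfl hτ (by rw [zero_sub, abs_neg, abs_of_nonneg hτ]))
    (hle b' b' τ τ hτ hτ (by simpa using hτ))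
  · simp_rw [← map_add]
    exact hgauss _
  · simp_rw [← map_sub]
    exact hgauss _

theorem tendsto_average_of_tendsto {R : ℝ → ℂ} {L : ℂ}
    (hR : ∀ K, 1 ≤ K → IntervalIntegrable R volume K (2 * K)) (hL : Tendsto R atTop (𝓝 L)) :
    Tendsto (fun K : ℝ => ((K : ℝ) : ℂ)⁻¹ * ∫ k in K..(2 * K), R k) atTop (𝓝 L) := by
  rw [Metric.tendsto_atTop] at hL ⊢
  intro ε hε
  obtain ⟨K₀, hK₀⟩ := hL (ε / 2) (half_pos hε)
  refine ⟨max K₀ 1, fun K hK => ?_⟩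
  have hK1 : 1 ≤ K := (le_max_right _ _).trans hK
  have hKpos : 0 < K := by linarith
  have hKc : ((K : ℝ) : ℂ) ≠ 0 := by exact_mod_cast hKpos.ne'
  have e : ((K : ℝ) : ℂ)⁻¹ * (∫ k in K..(2 * K), R k) - L
      = ((K : ℝ) : ℂ)⁻¹ * ∫ k in K..(2 * K), (R k - L) := by
    rw [intervalIntegral.integral_sub (hR K hK1) intervalIntegrable_const,
      intervalIntegral.integral_const, show 2 * K - K = K by ring, Complex.real_smul]
    field_simp
  have hb : ‖∫ k in K..(2 * K), (R k - L)‖ ≤ ε / 2 * |2 * K - K| := by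
    refine intervalIntegral.norm_integral_le_of_norm_le_const fun k hk => ?_
    rw [uIoc_of_le (by linarith)] at hk
    rw [← dist_eq_norm]
    exact (hK₀ k ((le_max_left _ _).trans (hK.trans hk.1.le))).le
  rw [show 2 * K - K = K by ring, abs_of_pos hKpos] at hb
  rw [dist_eq_norm, e, norm_mul, norm_inv, Complex.norm_real, Real.norm_of_nonneg hKpos.le,
    inv_mul_lt_iff₀ hKpos]
  calc _ ≤ _ := hb
    _ < K * ε := by nlinarith

theorem tendsto_integral_fieldTransform {D : Set (Rn n)} {m : ℝ} (hm : 0 ≤ m)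
    {μ : Rn n → ℝ} (hq : IsGaussianGeneralizedRandomFunction P q)
    (hiso : IsMicrolocallyIsotropic P q D m μ) {N : ℕ} (hD : D ⊆ Metric.closedBall 0 N)
    {θ : Rn n} (hθ : ‖θ‖ = 1) (τ : ℝ) :
    Tendsto (fun k : ℝ => ((k ^ m : ℝ) : ℂ) * ∫ w, fieldTransform N (q w) ((2 * k) • θ)
      * fieldTransform N (q w) (-((2 * (k + τ)) • θ)) ∂P) atTop
      (𝓝 (((2 ^ (-m) : ℝ) : ℂ) * waveTransform μ (-((2 * τ) • θ)))) := by
  obtain ⟨B, hB0, hB⟩ := exists_norm_integral_fieldTransform_mul_sub_le hm hq hiso hD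
  rw [tendsto_iff_norm_sub_tendsto_zero]
  have hlim : Tendsto (fun k : ℝ => B * k⁻¹) atTop (𝓝 0) := by
    simpa using tendsto_inv_atTop_zero.const_mul B
  refine squeeze_zero' (Eventually.of_forall fun k => norm_nonneg _) ?_ hlim
  filter_upwards [eventually_ge_atTop 1] with k hk
  have hkpos : 0 < k := by linarith
  have hnorm : ‖(2 * k) • θ‖ = 2 * k := by
    rw [norm_smul, hθ, mul_one, Real.norm_of_nonneg (by linarith)]
  have h1 := hB ((2 * k) • θ) (-((2 * (k + τ)) • θ)) (by rw [hnorm]; linarith)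
  rw [hnorm, show (2 * k) • θ + -((2 * (k + τ)) • θ) = -((2 * τ) • θ) by
    rw [← sub_eq_add_neg, ← sub_smul, ← neg_smul]; congr 1; ring] at h1
  have h2 : (((2 ^ (-m) : ℝ) : ℂ) * waveTransform μ (-((2 * τ) • θ)))
      = ((k ^ m : ℝ) : ℂ) * ((((2 * k) ^ (-m) : ℝ) : ℂ) * waveTransform μ (-((2 * τ) • θ))) := by
    rw [← mul_assoc, ← Complex.ofReal_mul, Real.mul_rpow (by norm_num) hkpos.le,
      mul_left_comm, ← Real.rpow_add hkpos, add_neg_cancel, Real.rpow_zero, mul_one]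
  rw [h2, ← mul_sub, norm_mul, Complex.norm_real, Real.norm_of_nonneg (by positivity)]
  have h3 : (1 + 2 * k) ^ (-(m + 1)) ≤ k ^ (-(m + 1)) :=
    Real.rpow_le_rpow_of_nonpos hkpos (by linarith) (by linarith)
  calc _ ≤ k ^ m * (B * k ^ (-(m + 1))) := by gcongr; exact h1.trans (by gcongr)
    _ = B * k⁻¹ := by
      rw [neg_add, Real.rpow_add hkpos, Real.rpow_neg_one, Real.rpow_neg hkpos.le]
      field_simp

/-- Splitting `k^m` into two half powers expresses the complex integrand through four real products
of Gaussian processes, to which the strong law applies. -/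
theorem fieldTransform_mul_conj {v : RealTest n →ₗ[ℝ] ℝ} {N : ℕ} {m : ℝ} {θ : Rn n} {τ k : ℝ}
    (hk : 0 < k) :
    ((k ^ m : ℝ) : ℂ) * (fieldTransform N v ((2 * k) • θ)
      * fieldTransform N v (-((2 * (k + τ)) • θ)))
    = ((v (scaledWaveTest m N θ false 0 k) * v (scaledWaveTest m N θ false τ k)
        + v (scaledWaveTest m N θ true 0 k) * v (scaledWaveTest m N θ true τ k) : ℝ) : ℂ)
      + Complex.I * ((v (scaledWaveTest m N θ true 0 k) * v (scaledWaveTest m N θ false τ k)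
        - v (scaledWaveTest m N θ false 0 k) * v (scaledWaveTest m N θ true τ k) : ℝ) : ℂ) := by
  have h : k ^ m = k ^ (m / 2) * k ^ (m / 2) := by rw [← Real.rpow_add hk, add_halves]
  rw [h]
  simp only [fieldTransform, scaledWaveTest, waveTest, map_smul, smul_eq_mul, cosTest_neg,
    sinTest_neg, map_neg, if_true, if_false, add_zero, Bool.false_eq_true]
  push_cast
  ring_nf
  rw [Complex.I_sq]
  ring

theorem ae_tendsto_average_fieldTransform {D : Set (Rn n)} {m : ℝ} (hm : 0 ≤ m)
    {μ : Rn n → ℝ} (hq : IsGaussianGeneralizedRandomFunction P q)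
    (hiso : IsMicrolocallyIsotropic P q D m μ) {N : ℕ} (hD : D ⊆ Metric.closedBall 0 N)
    {θ : Rn n} (hθ : ‖θ‖ = 1) {τ : ℝ} (hτ : 0 ≤ τ) :
    ∀ᵐ w ∂P, Continuous (fun k : ℝ => ((k ^ m : ℝ) : ℂ) * (fieldTransform N (q w) ((2 * k) • θ)
        * fieldTransform N (q w) (-((2 * (k + τ)) • θ)))) ∧
      Tendsto (fun K : ℝ => ((K : ℝ) : ℂ)⁻¹ * ∫ k in K..(2 * K), ((k ^ m : ℝ) : ℂ)
        * (fieldTransform N (q w) ((2 * k) • θ)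
          * fieldTransform N (q w) (-((2 * (k + τ)) • θ)))) atTop
        (𝓝 (((2 ^ (-m) : ℝ) : ℂ) * waveTransform μ (-((2 * τ) • θ)))) := by
  have hE := ae_tendsto_average_scaledWaveTest hm hq hiso hD hθ hτ
  filter_upwards [hq.ae_continuous_waveTest N, hE false false, hE true true, hE true false,
    hE false true] with w hw h00 h11 h10 h01
  set f : ℝ → ℂ := fun k => ((k ^ m : ℝ) : ℂ) * (fieldTransform N (q w) ((2 * k) • θ)
    * fieldTransform N (q w) (-((2 * (k + τ)) • θ))) with hf
  have hfc : Continuous f := by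
    have hft : Continuous fun ζ : Rn n => fieldTransform N (q w) ζ :=
      (Complex.continuous_ofReal.comp (hw false)).add
        (continuous_const.mul (Complex.continuous_ofReal.comp (hw true)))
    refine (Complex.continuous_ofReal.comp (Real.continuous_rpow_const hm)).mul
      ((hft.comp (by fun_prop : Continuous fun k : ℝ => (2 * k) • θ)).mul
        (hft.comp (by fun_prop : Continuous fun k : ℝ => -((2 * (k + τ)) • θ))))
  refine ⟨hfc, ?_⟩
  set R : ℝ → ℂ := fun k => ((k ^ m : ℝ) : ℂ) * ∫ w, fieldTransform N (q w) ((2 * k) • θ)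
      * fieldTransform N (q w) (-((2 * (k + τ)) • θ)) ∂P with hRdef
  have hRlim := tendsto_integral_fieldTransform hm hq hiso hD hθ τ
  set Z : Bool → Bool → ℝ → ℝ := fun b b' t => q w (scaledWaveTest m N θ b 0 t)
        * q w (scaledWaveTest m N θ b' τ t) - ∫ w', q w' (scaledWaveTest m N θ b 0 t)
        * q w' (scaledWaveTest m N θ b' τ t) ∂P with hZdef
  have hR : ∀ k, 0 < k → R k =
      (((∫ w', q w' (scaledWaveTest m N θ false 0 k) * q w' (scaledWaveTest m N θ false τ k) ∂P)
        + ∫ w', q w' (scaledWaveTest m N θ true 0 k)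
          * q w' (scaledWaveTest m N θ true τ k) ∂P : ℝ) : ℂ)
      + Complex.I * (((∫ w', q w' (scaledWaveTest m N θ true 0 k)
          * q w' (scaledWaveTest m N θ false τ k) ∂P)
        - ∫ w', q w' (scaledWaveTest m N θ false 0 k)
          * q w' (scaledWaveTest m N θ true τ k) ∂P : ℝ) : ℂ) := by
    intro k hk
    have i := hq.integrable_mul
    simp only [hRdef]
    rw [← integral_const_mul]
    simp_rw [fieldTransform_mul_conj hk]
    rw [← integral_add (i _ _) (i _ _), ← integral_sub (i _ _) (i _ _), ← integral_complex_ofReal,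
      ← integral_complex_ofReal, ← integral_const_mul, ← integral_add]
    · exact ((i _ _).add (i _ _)).ofReal
    · exact (((i _ _).sub (i _ _)).ofReal (𝕜 := ℂ)).const_mul _
  have hZ : ∀ k, 0 < k → f k - R k = ((Z false false k + Z true true k : ℝ) : ℂ)
      + Complex.I * ((Z true false k - Z false true k : ℝ) : ℂ) := by
    intro k hk
    rw [hR k hk]
    simp only [hf, hZdef]
    rw [fieldTransform_mul_conj hk]
    push_cast
    ring
  have hZi : ∀ (b b' : Bool), (∀ K, IntegrableOn (Z b b') (Ioc 1 K)) → ∀ K, 1 ≤ K →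
      IntervalIntegrable (Z b b') volume K (2 * K) := fun b b' h K hK =>
    (intervalIntegrable_iff_integrableOn_Ioc_of_le (by linarith)).2
      ((h (2 * K)).mono_set (Ioc_subset_Ioc_left hK))
  have hZa : ∀ K, 1 ≤ K → IntervalIntegrable (fun k => f k - R k) volume K (2 * K) ∧
      ∫ k in K..(2 * K), (f k - R k)
        = (((∫ k in K..(2 * K), Z false false k) + ∫ k in K..(2 * K), Z true true k : ℝ) : ℂ)
          + Complex.I * (((∫ k in K..(2 * K), Z true false k)
            - ∫ k in K..(2 * K), Z false true k : ℝ) : ℂ) := by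
    intro K hK
    have i00 := hZi false false h00.1 K hK
    have i11 := hZi true true h11.1 K hK
    have i10 := hZi true false h10.1 K hK
    have i01 := hZi false true h01.1 K hK
    have ia : IntervalIntegrable (fun k => ((Z false false k + Z true true k : ℝ) : ℂ)) volume K
        (2 * K) := ⟨(i00.add i11).1.ofReal, (i00.add i11).2.ofReal⟩
    have ib : IntervalIntegrable (fun k => Complex.I * ((Z true false k - Z false true k : ℝ) : ℂ))
        volume K (2 * K) :=
      IntervalIntegrable.const_mul (⟨(i10.sub i01).1.ofReal, (i10.sub i01).2.ofReal⟩) _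
    have hEq : ∀ k ∈ uIcc K (2 * K), f k - R k = ((Z false false k + Z true true k : ℝ) : ℂ)
      + Complex.I * ((Z true false k - Z false true k : ℝ) : ℂ) := by
      intro k hk
      rw [uIcc_of_le (by linarith)] at hk
      exact hZ k (by linarith [hk.1])
    refine ⟨(ia.add ib).congr fun k hk => (hEq k (uIoc_subset_uIcc hk)).symm, ?_⟩
    rw [intervalIntegral.integral_congr hEq, intervalIntegral.integral_add ia ib,
      intervalIntegral.integral_const_mul, intervalIntegral.integral_ofReal,
      intervalIntegral.integral_ofReal, intervalIntegral.integral_add i00 i11,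
      intervalIntegral.integral_sub i10 i01]
  -- Integrability of the mean follows from a single good realization: `f` is continuous and `f - R`
  -- is integrable by the strong law.
  have hRi : ∀ K, 1 ≤ K → IntervalIntegrable R volume K (2 * K) := by
    intro K hK
    have := (hfc.intervalIntegrable K (2 * K)).sub (hZa K hK).1
    simpa using this
  have hRavg := tendsto_average_of_tendsto hRi hRlim
  have hZavg : Tendsto (fun K : ℝ => ((K : ℝ) : ℂ)⁻¹ * ∫ k in K..(2 * K), (f k - R k))
      atTop (𝓝 0) := by
    have c1 := (Complex.continuous_ofReal.tendsto _).comp (h00.2.add h11.2)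
    have c2 := ((Complex.continuous_ofReal.tendsto _).comp (h10.2.sub h01.2)).const_mul Complex.I
    have c3 := c1.add c2
    simp only [add_zero, sub_zero, Complex.ofReal_zero, mul_zero] at c3
    refine c3.congr' ?_
    filter_upwards [eventually_ge_atTop 1] with K hK
    rw [(hZa K hK).2]
    simp only [Function.comp_apply]
    push_cast
    ring
  have := hZavg.add hRavg
  rw [zero_add] at this
  refine this.congr' ?_
  filter_upwards [eventually_ge_atTop 1] with K hK
  rw [intervalIntegral.integral_sub (hfc.intervalIntegrable _ _) (hRi K hK)]
  ring

theorem ae_hasSingleScatteringDatum {D : Set (Rn n)} {m : ℝ} (hm : 0 ≤ m)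
    {μ : Rn n → ℝ} (hq : IsGaussianGeneralizedRandomFunction P q)
    (hiso : IsMicrolocallyIsotropic P q D m μ) (hD : Bornology.IsBounded D)
    {θ : Rn n} (hθ : ‖θ‖ = 1) {τ : ℝ} (hτ : 0 ≤ τ) (cn : ℂ) :
    ∀ᵐ w ∂P, HasSingleScatteringDatum cn m (q w) τ θ
      (cn * (starRingEnd ℂ) cn * (((2 ^ (-m) : ℝ) : ℂ) * waveTransform μ (-((2 * τ) • θ)))) := by
  obtain ⟨r, hr⟩ := hD.subset_closedBall (0 : Rn n)
  obtain ⟨N, hN⟩ := exists_nat_ge r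
  have hDN : D ⊆ Metric.closedBall 0 (N : ℝ) := hr.trans (Metric.closedBall_subset_closedBall hN)
  filter_upwards [hiso.support, ae_tendsto_average_fieldTransform hm hq hiso hDN hθ hτ]
    with w hw hlim
  have e : bornIntegrand cn m (q w) τ θ = fun k => cn * (starRingEnd ℂ) cn * (((k ^ m : ℝ) : ℂ)
      * (fieldTransform N (q w) ((2 * k) • θ)
        * fieldTransform N (q w) (-((2 * (k + τ)) • θ)))) := by
    ext k
    rw [bornIntegrand, bornFarField_eq (hw.trans hDN), bornFarField_eq (hw.trans hDN),
      fieldTransform_neg, map_mul, fieldTransform, fieldTransform]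
    ring
  refine ⟨fun K _ => ?_, ?_⟩
  · rw [e]
    exact (continuous_const.mul hlim.1).intervalIntegrable _ _
  · rw [e]
    refine (hlim.2.const_mul (cn * (starRingEnd ℂ) cn)).congr fun K => ?_
    rw [intervalIntegral.integral_const_mul]
    ring

end

/-! ### Recovering the strength from its Fourier transform -/

section

open scoped FourierTransform SchwartzMap

variable {n : ℕ}

theorem waveTransform_injective {μ ν : Rn n → ℝ} (hμ : ContDiff ℝ ∞ μ) (hμc : HasCompactSupport μ)
    (hν : ContDiff ℝ ∞ ν) (hνc : HasCompactSupport ν) (h : waveTransform μ = waveTransform ν) :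
    μ = ν := by
  set S := toSchwartz (⟨μ, hμ, hμc, fun _ _ => trivial⟩ : RealTest n) with hS
  set T := toSchwartz (⟨ν, hν, hνc, fun _ _ => trivial⟩ : RealTest n) with hT
  have hF : 𝓕 S = 𝓕 T := by
    ext w
    have h1 := congrFun h (-((2 * Real.pi) • w))
    have h2 : ∀ U : 𝓢(Rn n, ℂ), 𝓕 U w = ∫ y, U y * planeWave (-((2 * Real.pi) • w)) y := by
      intro U
      rw [SchwartzMap.fourier_coe, fourier_eq_integral_planeWave]
      simp_rw [mul_comm]
    rw [h2, h2]
    exact h1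
  have hST : S = T := by
    rw [← FourierTransform.fourierInv_fourier_eq (E := 𝓢(Rn n, ℂ)) (F := 𝓢(Rn n, ℂ)) S, hF,
      FourierTransform.fourierInv_fourier_eq]
  ext x
  have := DFunLike.congr_fun hST x
  exact Complex.ofReal_injective this

theorem continuous_waveTransform {μ : Rn n → ℝ} (hμ : ContDiff ℝ ∞ μ)
    (hμc : HasCompactSupport μ) : Continuous (waveTransform μ) := by
  set S := toSchwartz (⟨μ, hμ, hμc, fun _ _ => trivial⟩ : RealTest n) with hS
  have : waveTransform μ = fun ζ => 𝓕 S (-((2 * Real.pi)⁻¹ • ζ)) := by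
    ext ζ
    rw [SchwartzMap.fourier_coe, ← integral_mul_planeWave_eq_fourier]
    rfl
  rw [this]
  exact (𝓕 S).continuous.comp (by fun_prop)

/-- The values of `waveTransform` along a dense set of polar coordinates determine the function. -/
theorem eq_of_waveTransform_eq_on_dense {p : ℕ → ℝ≥0 × Metric.sphere (0 : Rn n) 1}
    (hp : DenseRange p) {μ ν : Rn n → ℝ} (hμ : ContDiff ℝ ∞ μ) (hμc : HasCompactSupport μ)
    (hν : ContDiff ℝ ∞ ν) (hνc : HasCompactSupport ν)
    (h : ∀ j, waveTransform μ (-((2 * ((p j).1 : ℝ)) • ((p j).2 : Rn n)))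
      = waveTransform ν (-((2 * ((p j).1 : ℝ)) • ((p j).2 : Rn n)))) : μ = ν := by
  have hg : Continuous fun z : ℝ≥0 × Metric.sphere (0 : Rn n) 1 =>
      -((2 * (z.1 : ℝ)) • (z.2 : Rn n)) := by fun_prop
  have hall := hp.equalizer ((continuous_waveTransform hμ hμc).comp hg)
    ((continuous_waveTransform hν hνc).comp hg) (funext h)
  refine waveTransform_injective hμ hμc hν hνc (funext fun ξ => ?_)
  by_cases hξ : ξ = 0
  -- At the origin any direction serves; `p 0` supplies one.
  · have := congrFun hall (0, (p 0).2)
    simpa [hξ] using this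
  · have hn : 0 < ‖ξ‖ := norm_pos_iff.2 hξ
    -- The sampled frequency is `-2τθ`, so `ξ` is reached with `τ = ‖ξ‖/2` and the opposite
    -- direction.
    have hmem : -(‖ξ‖⁻¹ • ξ) ∈ Metric.sphere (0 : Rn n) 1 := by
      rw [mem_sphere_zero_iff_norm, norm_neg, norm_smul, norm_inv, norm_norm,
        inv_mul_cancel₀ hn.ne']
    have : waveTransform μ (-((2 * (‖ξ‖ / 2)) • -(‖ξ‖⁻¹ • ξ)))
        = waveTransform ν (-((2 * (‖ξ‖ / 2)) • -(‖ξ‖⁻¹ • ξ))) :=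
      congrFun hall (⟨‖ξ‖ / 2, by positivity⟩, ⟨_, hmem⟩)
    have e : -((2 * (‖ξ‖ / 2)) • -(‖ξ‖⁻¹ • ξ)) = ξ := by
      rw [smul_neg, neg_neg, smul_smul, mul_div_cancel₀ _ two_ne_zero, mul_inv_cancel₀ hn.ne',
        one_smul]
    rwa [e] at this

end

end

/-! ### The reconstruction map and the main theorem. -/

theorem theorem2 (n : ℕ) (hn : 2 ≤ n) (m : ℝ) (hm : (n : ℝ) - 1 < m) (cn : ℂ) (hcn : cn ≠ 0)
    (p : ℕ → ℝ≥0 × Metric.sphere (0 : Rn n) 1) (hp : DenseRange p) :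
    ∃ reconstruct : (ℕ → ℂ) → (Rn n → ℝ),
      ∀ (Ω : Type u) [MeasurableSpace Ω] (P : Measure Ω) [IsProbabilityMeasure P]
        (D : Set (Rn n)) (q : Ω → RealTest n →ₗ[ℝ] ℝ) (μ : Rn n → ℝ),
        IsOpen D → IsConnected D → Bornology.IsBounded D →
        IsGaussianGeneralizedRandomFunction P q →
        IsMicrolocallyIsotropic P q D m μ →
        ∀ᵐ w ∂P, ∃ M₁ : ℕ → ℂ,
          (∀ j, HasSingleScatteringDatum cn m (q w) ((p j).1 : ℝ) ((p j).2 : Rn n) (M₁ j)) ∧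
          reconstruct M₁ = μ := by
  classical
  have hm0 : 0 ≤ m := by
    have : (2 : ℝ) ≤ n := by exact_mod_cast hn
    linarith
  set data : (Rn n → ℝ) → ℕ → ℂ := fun μ j => cn * (starRingEnd ℂ) cn * (((2 ^ (-m) : ℝ) : ℂ)
    * waveTransform μ (-((2 * ((p j).1 : ℝ)) • ((p j).2 : Rn n)))) with hdata
  -- The inverse of the data map on smooth compactly supported functions, by choice; injectivity
  -- makes the choice unique, and `0` is the default off the range. Neither `D` nor the law of `q`
  -- enters.
  refine ⟨fun M => if h : ∃ μ : Rn n → ℝ, ContDiff ℝ ∞ μ ∧ HasCompactSupport μ ∧ data μ = M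
    then h.choose else 0, ?_⟩
  intro Ω _ P _ D q μ _ _ hDb hq hiso
  have hae := ae_all_iff.2 fun j => ae_hasSingleScatteringDatum hm0 hq hiso hDb
    (θ := ((p j).2 : Rn n)) (mem_sphere_zero_iff_norm.1 (p j).2.2) (NNReal.coe_nonneg (p j).1) cn
  filter_upwards [hae] with w hw
  refine ⟨data μ, hw, ?_⟩
  have hex : ∃ ν : Rn n → ℝ, ContDiff ℝ ∞ ν ∧ HasCompactSupport ν ∧ data ν = data μ :=
    ⟨μ, hiso.strength_smooth, hiso.strength_compact, rfl⟩
  simp only [dif_pos hex]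
  obtain ⟨h1, h2, h3⟩ := hex.choose_spec
  refine eq_of_waveTransform_eq_on_dense hp h1 h2 hiso.strength_smooth hiso.strength_compact
    fun j => ?_
  have hc : cn * (starRingEnd ℂ) cn ≠ 0 := mul_ne_zero hcn ((map_ne_zero _).2 hcn)
  have h2m : ((2 ^ (-m) : ℝ) : ℂ) ≠ 0 := Complex.ofReal_ne_zero.2 (by positivity)
  exact mul_left_cancel₀ h2m (mul_left_cancel₀ hc (congrFun h3 j))
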